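/- Let $\alpha,\beta>0$ be real numbers such that $\beta/\alpha$ is not an integer, let $\mathbb T=\mathbb R/2\pi\mathbb Z$, $\langle x\rangle=(1+|x|^2)^{1/2}$, and for $u$ on $\mathbb R\times\mathbb T$ put $$\widehat u_k(t)=\int_{\mathbb T}e^{-ikx}u(t,x)\,dx,\qquad \tilde u(k,\tau)=\int_{\mathbb R}e^{-i\tau t}\,\widehat u_k(t)\,dt ,\qquad u(t,x)=\frac1{2\pi}\sum_{k\in\mathbb Z}\widehat u_k(t)e^{ikx}.$$ Write $\|a\|_{\ell^2_k}=\big(\frac1{2\pi}\sum_{k\in\mathbb Z}|a_k|^2\big)^{1/2}$, $\sigma_S=\tau-\alpha k^2$, $\sigma_W=|\tau|-\beta|k|$, and for $s\in\mathbb R$ and $\ast\in\{S,W\}$ let $$\|u\|_{Y^s_\ast}=\big\|\langle k\rangle^s\langle\sigma_\ast\rangle^{1/2}\tilde u\big\|_{\ell^2_kL^2_\tau}+\big\|\langle k\rangle^s\tilde u\big\|_{\ell^2_kL^1_\tau},\qquad \|u\|_{Z^s_\ast}=\big\|\langle k\rangle^s\langle\sigma_\ast\rangle^{-1/2}\tilde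 u\big\|_{\ell^2_kL^2_\tau}+\big\|\langle k\rangle^s\langle\sigma_\ast\rangle^{-1}\tilde u\big\|_{\ell^2_kL^1_\tau}.$$ For a dyadic number $N\in\{1,2,4,8,\dots\}$ let $\widehat{P_Nu}_k=1_{N\le|k|<2N}\,\widehat u_k$. For $C>0$, call $(k_0,k_1,k_2)\in\mathbb Z^3$ resonant (with constant $C$) if $|k_i|\le C|k_j|$ for all $i,j\in\{0,1,2\}$ with $i\ne j$, and nonresonant otherwise. Then there is $\delta_0>0$ such that for every $C>2$ and every $0<\delta\le\delta_0$ there is a constant $K>0$ (depending only on $\alpha,\beta,C,\delta$) such that the following two estimates hold for all dyadic numbers $N_0,N_1,N_2$, with $N_{max}=\max\{N_0,N_1,N_2\}$. (1) If every triple of integers with $k_0=k_1+k_2$ and $N_i\le|k_i|<2N_i$ $(i=0,1,2)$ is nonresonant with constant $C$, then for all $u\in Y^0_S$ and $v\in Y^{-1/2}_W$ $$\big\|P_{N_0}\big(P_{N_1}u\;P_{N_2}v\big)\big\|_{Z^0_S}\le K\,N_{max}^{-\delta}\,\|u\|_{Y^0_S}\,\|v\|_{Y^{-1/2}_W}.$$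 (2) If every triple of integers with $k_0=k_1-k_2$ and $N_i\le|k_i|<2N_i$ $(i=0,1,2)$ is nonresonant with constant $C$, then for all $u,v\in Y^0_S$ $$\big\|P_{N_0}\,\partial_x\big(P_{N_1}u\;\overline{P_{N_2}v}\big)\big\|_{Z^{-1/2}_W}\le K\,N_{max}^{-\delta}\,\|u\|_{Y^0_S}\,\|v\|_{Y^0_S}.$$ -/

import Mathlib

open MeasureTheory
open scoped ENNReal FourierTransform ComplexConjugate

namespace Zakharov

noncomputable section

/-- The bracket `⟨x⟩ = (1 + |x|²)^{1/2}`. -/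
def bracket (x : ℝ) : ℝ := Real.sqrt (1 + x ^ 2)

/-- The `ℓ²_k` norm on `ℤ` for the normalized counting measure `(1/2π) ∑_k`, valued in `[0, ∞]`. -/
def ell2 (a : ℤ → ℝ≥0∞) : ℝ≥0∞ :=
  (ENNReal.ofReal (1 / (2 * Real.pi)) * ∑' k : ℤ, a k ^ (2 : ℝ)) ^ (1 / 2 : ℝ)

/-! ### Functions and distributions on `ℝ × 𝕋`, `𝕋 = ℝ / 2πℤ` -/

/-- A distribution `u(t,x) = (1/2π) ∑_k û_k(t) e^{ikx}` on `ℝ × 𝕋` whose spatial Fourier coefficients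
`û_k` are square integrable in time; there is no condition on the growth in `k`.
Every distribution whose space-time Fourier transform is a function with a finite `X^{s,b}` norm,
`b ≥ 0`, is of this form; in particular every element of the spaces `Y_S^s` and `Y_W^s` is. -/
abbrev SpaceTime : Type := ℤ → Lp ℂ 2 (volume : Measure ℝ)

/-- The space-time Fourier transform `ũ(k,τ) = ∫ e^{-iτt} û_k(t) dt` of `u`, where the integral is
the `L²` Fourier transform (Mathlib's `𝓕` has the kernel `e^{-2πi tξ}`, hence `ξ = τ/2π`). -/
def SpaceTime.fourier (u : SpaceTime) (k : ℤ) (τ : ℝ) : ℂ :=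
  (𝓕 (u k) : Lp ℂ 2 (volume : Measure ℝ)) (τ / (2 * Real.pi))

/-- The spatial Fourier coefficients `û_k(t)` of `u`, as functions of time. -/
def SpaceTime.coeff (u : SpaceTime) (k : ℤ) (t : ℝ) : ℂ := u k t

/-- The spatial Fourier coefficients `∫_𝕋 e^{-ikx} F(t,x) dx` of a function `F(t,x)` that is
`2π`-periodic in `x`. -/
def spatialCoeff (F : ℝ → ℝ → ℂ) (k : ℤ) (t : ℝ) : ℂ :=
  ∫ x in (0 : ℝ)..(2 * Real.pi), Complex.exp (-(Complex.I * k * x)) * F t x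

/-- The space-time Fourier transform `∬_{ℝ × 𝕋} e^{-ikx} e^{-iτt} F(t,x) dx dt` of a function. -/
def spaceTimeFourier (F : ℝ → ℝ → ℂ) (k : ℤ) (τ : ℝ) : ℂ :=
  ∫ t : ℝ, Complex.exp (-(Complex.I * τ * t)) * spatialCoeff F k t

/-- The frequencies `k` with `N ≤ |k| < 2N`. -/
def block (N : ℕ) : Finset ℤ :=
  (Finset.Ioo (-(2 * N : ℤ)) (2 * N)).filter fun k => (N : ℤ) ≤ |k|

/-- The Littlewood-Paley piece `P_N u(t,x) = (1/2π) ∑_{N ≤ |k| < 2N} û_k(t) e^{ikx}`, for given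
spatial Fourier coefficients `û_k(t)`. -/
def littlewoodPaley (N : ℕ) (c : ℤ → ℝ → ℂ) (t x : ℝ) : ℂ :=
  1 / (2 * Real.pi) * ∑ k ∈ block N, c k t * Complex.exp (Complex.I * k * x)

/-! ### The norms, as functions of the space-time Fourier transform `f(k,τ)` -/

/-- The norm of `X_S^{s,b}`. -/
def normXS (α s b : ℝ) (f : ℤ → ℝ → ℂ) : ℝ≥0∞ :=
  ell2 fun k => eLpNorm
    (fun τ : ℝ => ((bracket k ^ s * bracket (τ - α * k ^ 2) ^ b : ℝ) : ℂ) * f k τ) 2 volume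

/-- The norm of `X_W^{s,b}`. -/
def normXW (β s b : ℝ) (f : ℤ → ℝ → ℂ) : ℝ≥0∞ :=
  ell2 fun k => eLpNorm
    (fun τ : ℝ => ((bracket k ^ s * bracket (|τ| - β * |(k : ℝ)|) ^ b : ℝ) : ℂ) * f k τ) 2 volume

/-- The norm of `Y_S^s`. -/
def normYS (α s : ℝ) (f : ℤ → ℝ → ℂ) : ℝ≥0∞ :=
  normXS α s (1 / 2) f +
    ell2 fun k => eLpNorm (fun τ : ℝ => ((bracket k ^ s : ℝ) : ℂ) * f k τ) 1 volume

/-- The norm of `Y_W^s`. -/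
def normYW (β s : ℝ) (f : ℤ → ℝ → ℂ) : ℝ≥0∞ :=
  normXW β s (1 / 2) f +
    ell2 fun k => eLpNorm (fun τ : ℝ => ((bracket k ^ s : ℝ) : ℂ) * f k τ) 1 volume

/-- The norm of `Z_S^s`. -/
def normZS (α s : ℝ) (f : ℤ → ℝ → ℂ) : ℝ≥0∞ :=
  normXS α s (-1 / 2) f +
    ell2 fun k => eLpNorm
      (fun τ : ℝ => ((bracket k ^ s / bracket (τ - α * k ^ 2) : ℝ) : ℂ) * f k τ) 1 volume

/-- The norm of `Z_W^s`. -/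
def normZW (β s : ℝ) (f : ℤ → ℝ → ℂ) : ℝ≥0∞ :=
  normXW β s (-1 / 2) f +
    ell2 fun k => eLpNorm
      (fun τ : ℝ => ((bracket k ^ s / bracket (|τ| - β * |(k : ℝ)|) : ℝ) : ℂ) * f k τ) 1 volume

/-! ### Frequency interactions -/

/-- `N` is a dyadic number `2^j`, `j ≥ 0` (for `N < 1` no integer satisfies `N ≤ |k| < 2N`). -/
def IsDyadic (N : ℕ) : Prop := ∃ j : ℕ, N = 2 ^ j

/-- `|a| ∼ |b|` with the comparability constant `C`. -/
def Comparable (C : ℝ) (a b : ℤ) : Prop :=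
  |(a : ℝ)| ≤ C * |(b : ℝ)| ∧ |(b : ℝ)| ≤ C * |(a : ℝ)|

/-- The resonant set `k₀ ∼ k₁ ∼ k₂`, with the comparability constant `C`. -/
def resonantSet (C : ℝ) : Set (ℤ × ℤ × ℤ) :=
  {k | Comparable C k.1 k.2.1 ∧ Comparable C k.2.1 k.2.2 ∧ Comparable C k.1 k.2.2}

/-- The nonresonant set: the complement of the resonant set. -/
def nonresonantSet (C : ℝ) : Set (ℤ × ℤ × ℤ) := (resonantSet C)ᶜ

/-- All interactions `k₁ + k₂ = k₀` of frequencies `N_i ≤ |k_i| < 2N_i` are nonresonant. -/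
def NonresonantSum (C : ℝ) (N₀ N₁ N₂ : ℕ) : Prop :=
  ∀ k₀ ∈ block N₀, ∀ k₁ ∈ block N₁, ∀ k₂ ∈ block N₂,
    k₀ = k₁ + k₂ → (k₀, k₁, k₂) ∈ nonresonantSet C

/-- All interactions `k₁ - k₂ = k₀` of frequencies `N_i ≤ |k_i| < 2N_i` are nonresonant. -/
def NonresonantDiff (C : ℝ) (N₀ N₁ N₂ : ℕ) : Prop :=
  ∀ k₀ ∈ block N₀, ∀ k₁ ∈ block N₁, ∀ k₂ ∈ block N₂,
    k₀ = k₁ - k₂ → (k₀, k₁, k₂) ∈ nonresonantSet C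

/-! ### The localized nonlinearities -/

/-- `P_{N₀}(P_{N₁}u · P_{N₂}v)`. -/
def schrodingerTerm (N₀ N₁ N₂ : ℕ) (u v : SpaceTime) : ℝ → ℝ → ℂ :=
  littlewoodPaley N₀ (spatialCoeff fun t x =>
    littlewoodPaley N₁ u.coeff t x * littlewoodPaley N₂ v.coeff t x)

/-- `P_{N₀} ∂ₓ(P_{N₁}u · conj (P_{N₂}v))`. -/
def waveTerm (N₀ N₁ N₂ : ℕ) (u v : SpaceTime) : ℝ → ℝ → ℂ :=
  littlewoodPaley N₀ (spatialCoeff fun t x =>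
    deriv (fun y : ℝ => littlewoodPaley N₁ u.coeff t y * conj (littlewoodPaley N₂ v.coeff t y)) x)

end

end Zakharov

open Zakharov

open Zakharov

/-! On the Fourier side both estimates are instances of one trilinear inequality on `ℤ × ℝ`: a form
`∬ f(x) g(y) h(x - y)` in which `f`, `g` carry Schrödinger weights and `h` a wave weight. In (1) the
dual function takes the place of `f`, in (2) that of `h`. The lemmas
`enorm_spaceTimeFourier_schrodingerTerm_le` and `enorm_spaceTimeFourier_waveTerm_le` pass to
absolute values, and `l2norm_le_of_forall_lintegral_mul_le` supplies the duality.

The gain comes from the resonance identity. If `k`, `l` are the Schrödinger frequencies, the wave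
frequency is `n = k - l`, and a signed sum of the three modulations equals `n (α(k + l) ∓ β)`. As
`β/α` is not an integer, `|αm ∓ β|` is bounded below by `c` and by `c|m|` for every integer `m`,
while nonresonance makes `|k + l|` comparable to the largest frequency. Hence some modulation is at
least of order `N_wave N_max` (`exists_modulation_lower_bound`), and its power 7/16 gains `(N_wave
N_max)^(-7/16)`.

The weights `⟨σ⟩^(-7/16)` of the other two modulations form a kernel, and Cauchy-Schwarz leaves its
`L²` norm with one of the three points fixed. Integrating the square in time leaves `⟨d_k⟩^(-5/8)`,
where `d_k` is the gap between a parabola and a line or between two parabolas. These gaps are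
separated as `k` varies, so the squared norm is `O(N_max^(1/2))` (`exists_kernel_bound`). In total
`N_max^(1/4 - 7/16) N_wave^(-7/16) ≤ N_max^(-1/8) N_wave^(-1/2)` (`exists_trilinear_bound`).

The factor `N_wave^(-1/2)` pays for the half derivative lost in (1) through `Y_W^{-1/2}` and in (2)
through `∂ₓ` measured in `Z_W^{-1/2}`; what remains gives `δ₀ = 1/8`. Working with 7/16 instead of
1/2 also handles the `L¹` part of the `Z` norms, because `⟨σ⟩^(-9/16)` is square integrable
(`ell2_add_ell2_le`). -/

/-! ### Fourier transform in time of products of `L²` functions. -/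

/-- The character `t ↦ e^{-2πiξt}`. -/
noncomputable def timeChar (ξ t : ℝ) : ℂ :=
  Complex.exp (((-(2 * Real.pi * ξ * t) : ℝ) : ℂ) * Complex.I)

lemma norm_timeChar (ξ t : ℝ) : ‖timeChar ξ t‖ = 1 := Complex.norm_exp_ofReal_mul_I _

lemma continuous_timeChar (ξ : ℝ) : Continuous (timeChar ξ) := by
  unfold timeChar; fun_prop

lemma conj_timeChar (ξ t : ℝ) : conj (timeChar ξ t) = timeChar (-ξ) t := by
  unfold timeChar
  rw [← Complex.exp_conj, map_mul, Complex.conj_ofReal, Complex.conj_I]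
  congr 1
  push_cast; ring

lemma timeChar_mul (ξ η t : ℝ) : timeChar ξ t * timeChar η t = timeChar (ξ + η) t := by
  unfold timeChar
  rw [← Complex.exp_add]
  congr 1
  push_cast; ring

lemma fourier_eq_integral_timeChar (f : ℝ → ℂ) (ξ : ℝ) :
    𝓕 f ξ = ∫ t, timeChar ξ t * f t := by
  rw [Real.fourier_eq']
  refine integral_congr_ae (Filter.Eventually.of_forall fun t => ?_)
  simp only [timeChar, smul_eq_mul, Real.inner_apply]
  congr 2; push_cast; ring

lemma MemLp.timeChar_mul {f : ℝ → ℂ} (hf : MemLp f 2) (ξ : ℝ) :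
    MemLp (fun t => timeChar ξ t * f t) 2 := by
  refine hf.of_le ((continuous_timeChar ξ).aestronglyMeasurable.mul hf.1) ?_
  filter_upwards with t
  simp [norm_timeChar]

/-- The integral is the inner product with the conjugate of `G`; this provides the closedness needed
in the density arguments. -/
lemma continuous_integral_mul_of_memLp {G : ℝ → ℂ} (hG : MemLp G 2) :
    Continuous fun f : Lp ℂ 2 (volume : Measure ℝ) => ∫ t, f t * G t := by
  have h : (fun f : Lp ℂ 2 (volume : Measure ℝ) => ∫ t, f t * G t) =
      fun f => inner ℂ (hG.star.toLp (star G)) f := by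
    funext f
    rw [L2.inner_def]
    refine integral_congr_ae ?_
    filter_upwards [hG.star.coeFn_toLp] with t ht
    simp [ht, RCLike.inner_apply]
  rw [h]
  fun_prop

/-- This is the self-adjointness of the Fourier transform applied to `𝓕⁻ f` and `G`; the reflection
`η ↦ -η` then turns `𝓕⁻ f` into `𝓕 f`. -/
lemma integral_mul_eq_integral_fourier_mul (f : SchwartzMap ℝ ℂ) {G : ℝ → ℂ}
    (hG : Integrable G) : ∫ t, f t * G t = ∫ η, 𝓕 (f : ℝ → ℂ) η * 𝓕 G (-η) := by
  have h1 : ∀ t, f t = 𝓕 ((𝓕⁻ f : SchwartzMap ℝ ℂ) : ℝ → ℂ) t := fun t => by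
    rw [← SchwartzMap.fourier_coe, FourierTransform.fourier_fourierInv_eq]
  have h2 := VectorFourier.integral_fourierIntegral_smul_eq_flip (L := innerₗ ℝ)
    Real.continuous_fourierChar continuous_inner (μ := volume) (ν := volume)
    (𝓕⁻ f : SchwartzMap ℝ ℂ).integrable hG
  have h3 : ∫ t, f t * G t = ∫ x, (𝓕⁻ f : SchwartzMap ℝ ℂ) x * 𝓕 G x := by
    simp_rw [h1]
    simpa [Real.fourier_eq, VectorFourier.fourierIntegral] using! h2
  rw [h3, ← integral_neg_eq_self]
  refine integral_congr_ae (Filter.Eventually.of_forall fun η => ?_)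
  simp only
  congr 1
  rw [SchwartzMap.fourierInv_coe, Real.fourierInv_eq_fourier_neg, neg_neg]

lemma SchwartzMap.l2_dense_induction {p : Lp ℂ 2 (volume : Measure ℝ) → Prop}
    (f : Lp ℂ 2 (volume : Measure ℝ)) (hp : IsClosed {f | p f})
    (h : ∀ φ : SchwartzMap ℝ ℂ, p (φ.toLp 2 volume)) : p f :=
  DenseRange.induction_on (p := p)
    (SchwartzMap.denseRange_toLpCLM (F := ℂ) (p := 2) (μ := (volume : Measure ℝ))
      ENNReal.ofNat_ne_top) f hp h

lemma measurePreserving_const_sub (ξ : ℝ) :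
    MeasurePreserving (fun η : ℝ => ξ - η) volume volume :=
  Measure.measurePreserving_sub_left volume ξ

lemma SchwartzMap.coeFn_fourier_toLp (φ : SchwartzMap ℝ ℂ) :
    (𝓕 (φ.toLp 2 volume) : Lp ℂ 2 (volume : Measure ℝ)) =ᵐ[volume] 𝓕 (φ : ℝ → ℂ) := by
  rw [SchwartzMap.toLp_fourier_eq, ← SchwartzMap.fourier_coe]
  exact SchwartzMap.coeFn_toLp _ _ volume

/-- The Fourier transform of a product of two functions in `L²`. -/
theorem integral_timeChar_mul_mul (f g : Lp ℂ 2 (volume : Measure ℝ)) (ξ : ℝ) :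
    ∫ t, timeChar ξ t * (f t * g t) =
      ∫ η, (𝓕 f : Lp ℂ 2 (volume : Measure ℝ)) η *
        (𝓕 g : Lp ℂ 2 (volume : Measure ℝ)) (ξ - η) := by
  have hmp := measurePreserving_const_sub ξ
  -- For fixed `ξ` both sides are continuous in each factor for the `L²` topology, so it suffices to
  -- treat Schwartz functions, first for `f` and then for `g`.
  refine SchwartzMap.l2_dense_induction (p := fun f : Lp ℂ 2 (volume : Measure ℝ) =>
    ∫ t, timeChar ξ t * (f t * g t) = ∫ η, (𝓕 f : Lp ℂ 2 (volume : Measure ℝ)) η *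
        (𝓕 g : Lp ℂ 2 (volume : Measure ℝ)) (ξ - η)) f (isClosed_eq ?_ ?_) fun φ => ?_
  · convert! continuous_integral_mul_of_memLp (MemLp.timeChar_mul (Lp.memLp g) ξ) using 4
    ring
  · exact (continuous_integral_mul_of_memLp
      ((Lp.memLp (𝓕 g)).comp_measurePreserving hmp)).comp
        (Lp.fourierTransformₗᵢ ℝ ℂ).continuous
  refine SchwartzMap.l2_dense_induction (p := fun g : Lp ℂ 2 (volume : Measure ℝ) =>
    ∫ t, timeChar ξ t * (φ.toLp 2 volume t * g t) =
      ∫ η, (𝓕 (φ.toLp 2 volume) : Lp ℂ 2 (volume : Measure ℝ)) η *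
        (𝓕 g : Lp ℂ 2 (volume : Measure ℝ)) (ξ - η)) g (isClosed_eq ?_ ?_) fun ψ => ?_
  · convert! continuous_integral_mul_of_memLp
      (MemLp.timeChar_mul (Lp.memLp (φ.toLp 2 volume)) ξ) using 4
    ring
  · have h := (continuous_integral_mul_of_memLp
      ((Lp.memLp (𝓕 (φ.toLp 2 volume))).comp_measurePreserving hmp)).comp
        (Lp.fourierTransformₗᵢ ℝ ℂ).continuous
    convert! h using 2 with g
    simp only [Function.comp_apply]
    rw [← integral_sub_left_eq_self _ volume ξ]
    refine integral_congr_ae (Filter.Eventually.of_forall fun η => ?_)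
    simp only [sub_sub_cancel]
    exact mul_comm _ _
  · have e1 : ∫ t, timeChar ξ t * (φ.toLp 2 volume t * ψ.toLp 2 volume t) =
        ∫ t, φ t * (timeChar ξ t * ψ t) := by
      refine integral_congr_ae ?_
      filter_upwards [φ.coeFn_toLp 2 volume, ψ.coeFn_toLp 2 volume] with t h1 h2
      rw [h1, h2]; ring
    have hint : Integrable fun t => timeChar ξ t * ψ t :=
      ψ.integrable.bdd_mul (c := 1) (continuous_timeChar ξ).aestronglyMeasurable
        (Filter.Eventually.of_forall fun t => (norm_timeChar ξ t).le)
    rw [e1, integral_mul_eq_integral_fourier_mul φ hint]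
    refine integral_congr_ae ?_
    filter_upwards [φ.coeFn_fourier_toLp,
      hmp.quasiMeasurePreserving.ae_eq_comp ψ.coeFn_fourier_toLp] with η h1 h2
    simp only [Function.comp_apply] at h2
    rw [h1, h2, fourier_eq_integral_timeChar _ (-η), fourier_eq_integral_timeChar _ (ξ - η)]
    congr 2; funext t
    rw [← mul_assoc, timeChar_mul]; congr 2; ring

/-- The Fourier transform of `f · conj g` for `f` and `g` in `L²`. -/
theorem integral_timeChar_mul_mul_conj (f g : Lp ℂ 2 (volume : Measure ℝ)) (ξ : ℝ) :
    ∫ t, timeChar ξ t * (f t * conj (g t)) =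
      ∫ η, (𝓕 f : Lp ℂ 2 (volume : Measure ℝ)) η *
        conj ((𝓕 g : Lp ℂ 2 (volume : Measure ℝ)) (η - ξ)) := by
  have hmp : MeasurePreserving (fun η : ℝ => η - ξ) volume volume :=
    measurePreserving_sub_right volume ξ
  have hmp' : MeasurePreserving (fun η : ℝ => η + ξ) volume volume :=
    measurePreserving_add_right volume ξ
  refine SchwartzMap.l2_dense_induction (p := fun f : Lp ℂ 2 (volume : Measure ℝ) =>
    ∫ t, timeChar ξ t * (f t * conj (g t)) = ∫ η, (𝓕 f : Lp ℂ 2 (volume : Measure ℝ)) η *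
        conj ((𝓕 g : Lp ℂ 2 (volume : Measure ℝ)) (η - ξ))) f (isClosed_eq ?_ ?_) fun φ => ?_
  · convert! continuous_integral_mul_of_memLp (MemLp.timeChar_mul (Lp.memLp g).star ξ) using 4
    simp only [Pi.star_apply, RCLike.star_def]
    ring
  · exact (continuous_integral_mul_of_memLp
      ((Lp.memLp (𝓕 g)).comp_measurePreserving hmp).star).comp
        (Lp.fourierTransformₗᵢ ℝ ℂ).continuous
  -- After conjugation both sides are linear rather than antilinear in `g`, so that
  -- `continuous_integral_mul_of_memLp` applies.
  apply (starRingEnd ℂ).injective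
  refine SchwartzMap.l2_dense_induction (p := fun g : Lp ℂ 2 (volume : Measure ℝ) =>
    conj (∫ t, timeChar ξ t * (φ.toLp 2 volume t * conj (g t))) =
      conj (∫ η, (𝓕 (φ.toLp 2 volume) : Lp ℂ 2 (volume : Measure ℝ)) η *
        conj ((𝓕 g : Lp ℂ 2 (volume : Measure ℝ)) (η - ξ)))) g (isClosed_eq ?_ ?_) fun ψ => ?_
  · convert! continuous_integral_mul_of_memLp
      (MemLp.timeChar_mul (Lp.memLp (φ.toLp 2 volume)) ξ).star using 2 with g
    rw [← integral_conj]
    refine integral_congr_ae (Filter.Eventually.of_forall fun η => ?_)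
    simp
    ring
  · have h := (continuous_integral_mul_of_memLp
      ((Lp.memLp (𝓕 (φ.toLp 2 volume))).comp_measurePreserving hmp').star).comp
        (Lp.fourierTransformₗᵢ ℝ ℂ).continuous
    convert! h using 2 with g
    simp only [Function.comp_apply]
    rw [← integral_conj, ← integral_add_right_eq_self _ ξ]
    refine integral_congr_ae (Filter.Eventually.of_forall fun η => ?_)
    simp only [add_sub_cancel_right, map_mul, Complex.conj_conj]
    exact mul_comm _ _
  · congr 1
    have e1 : ∫ t, timeChar ξ t * (φ.toLp 2 volume t * conj (ψ.toLp 2 volume t)) =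
        ∫ t, φ t * (timeChar ξ t * conj (ψ t)) := by
      refine integral_congr_ae ?_
      filter_upwards [φ.coeFn_toLp 2 volume, ψ.coeFn_toLp 2 volume] with t h1 h2
      rw [h1, h2]; ring
    have hint : Integrable fun t => timeChar ξ t * conj (ψ t) := by
      refine Integrable.bdd_mul (c := 1) ?_ (continuous_timeChar ξ).aestronglyMeasurable
        (Filter.Eventually.of_forall fun t => (norm_timeChar ξ t).le)
      exact (Complex.conjLIE.integrable_comp_iff).2 ψ.integrable
    rw [e1, integral_mul_eq_integral_fourier_mul φ hint]
    refine integral_congr_ae ?_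
    filter_upwards [φ.coeFn_fourier_toLp,
      hmp.quasiMeasurePreserving.ae_eq_comp ψ.coeFn_fourier_toLp] with η h1 h2
    simp only [Function.comp_apply] at h2
    rw [h1, h2, fourier_eq_integral_timeChar _ (-η), fourier_eq_integral_timeChar _ (η - ξ),
      ← integral_conj]
    congr 2; funext t
    rw [map_mul, conj_timeChar, ← mul_assoc, timeChar_mul]; congr 2; ring

/-! ### Spatial Fourier coefficients of trigonometric polynomials. -/

lemma integral_exp_neg_mul_exp (k m : ℤ) :
    ∫ x in (0 : ℝ)..(2 * Real.pi),
      Complex.exp (-(Complex.I * k * x)) * Complex.exp (Complex.I * m * x) =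
      if m = k then ((2 * Real.pi : ℝ) : ℂ) else 0 := by
  have h : ∀ x : ℝ, Complex.exp (-(Complex.I * k * x)) * Complex.exp (Complex.I * m * x) =
      Complex.exp ((((m - k : ℤ) : ℂ) * Complex.I) * x) := fun x => by
    rw [← Complex.exp_add]; congr 1; push_cast; ring
  simp_rw [h]
  split_ifs with hmk
  · simp [hmk]
  · have hne : ((m - k : ℤ) : ℂ) * Complex.I ≠ 0 :=
      mul_ne_zero (Int.cast_ne_zero.2 (sub_ne_zero.2 hmk)) Complex.I_ne_zero
    rw [integral_exp_mul_complex hne]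
    have h1 : ((m - k : ℤ) : ℂ) * Complex.I * ((2 * Real.pi : ℝ) : ℂ) =
        ((m - k : ℤ) : ℂ) * (2 * Real.pi * Complex.I) := by push_cast; ring
    rw [h1, Complex.exp_int_mul_two_pi_mul_I]
    simp

/-- The frequency map `m` need not be injective, so that products, indexed by pairs of frequencies,
are covered as well. -/
lemma spatialCoeff_trigPoly {ι : Type*} (s : Finset ι) (a : ι → ℝ → ℂ) (m : ι → ℤ) (k : ℤ)
    (t : ℝ) :
    spatialCoeff (fun t x => ∑ i ∈ s, a i t * Complex.exp (Complex.I * m i * x)) k t =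
      2 * Real.pi * ∑ i ∈ s with m i = k, a i t := by
  unfold spatialCoeff
  simp_rw [Finset.mul_sum]
  rw [intervalIntegral.integral_finsetSum]
  · rw [Finset.sum_filter]
    refine Finset.sum_congr rfl fun i _ => ?_
    have h : ∀ x : ℝ, Complex.exp (-(Complex.I * k * x)) *
        (a i t * Complex.exp (Complex.I * m i * x)) =
        a i t * (Complex.exp (-(Complex.I * k * x)) * Complex.exp (Complex.I * m i * x)) :=
      fun x => by ring
    simp_rw [h]
    rw [intervalIntegral.integral_const_mul, integral_exp_neg_mul_exp]
    split_ifs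
    · push_cast; ring
    · simp
  · intro i _
    exact Continuous.intervalIntegrable (by fun_prop) _ _

lemma spatialCoeff_littlewoodPaley (N : ℕ) (c : ℤ → ℝ → ℂ) (k : ℤ) (t : ℝ) :
    spatialCoeff (littlewoodPaley N c) k t = if k ∈ block N then c k t else 0 := by
  have h : littlewoodPaley N c = fun (t x : ℝ) => ∑ j ∈ block N,
      (1 / (2 * Real.pi) * c j t) * Complex.exp (Complex.I * (id j : ℤ) * x) := by
    funext t x
    simp [littlewoodPaley, Finset.mul_sum, mul_assoc]
  rw [h, spatialCoeff_trigPoly]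
  have hpi : (Real.pi : ℂ) ≠ 0 := Complex.ofReal_ne_zero.2 Real.pi_ne_zero
  simp only [id, Finset.filter_eq']
  split_ifs
  · simp; field_simp
  · simp

lemma spatialCoeff_mul_littlewoodPaley (N₁ N₂ : ℕ) (c d : ℤ → ℝ → ℂ) (k : ℤ) (t : ℝ) :
    spatialCoeff (fun t x => littlewoodPaley N₁ c t x * littlewoodPaley N₂ d t x) k t =
      1 / (2 * Real.pi) * ∑ p ∈ block N₁ ×ˢ block N₂ with p.1 + p.2 = k, c p.1 t * d p.2 t := by
  have h : (fun t x => littlewoodPaley N₁ c t x * littlewoodPaley N₂ d t x) =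
      fun (t x : ℝ) => ∑ p ∈ block N₁ ×ˢ block N₂,
      (1 / (2 * Real.pi) * (1 / (2 * Real.pi)) * (c p.1 t * d p.2 t)) *
        Complex.exp (Complex.I * (p.1 + p.2 : ℤ) * x) := by
    funext t x
    simp only [littlewoodPaley, Finset.mul_sum, Finset.sum_mul, Finset.sum_product]
    rw [Finset.sum_comm]
    refine Finset.sum_congr rfl fun i _ => Finset.sum_congr rfl fun j _ => ?_
    have e : Complex.exp (Complex.I * (i + j : ℤ) * x) =
        Complex.exp (Complex.I * i * x) * Complex.exp (Complex.I * j * x) := by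
      rw [← Complex.exp_add]; congr 1; push_cast; ring
    rw [e]; ring
  rw [h, spatialCoeff_trigPoly, ← Finset.mul_sum]
  have hpi : (Real.pi : ℂ) ≠ 0 := Complex.ofReal_ne_zero.2 Real.pi_ne_zero
  field_simp

lemma spatialCoeff_deriv_mul_conj_littlewoodPaley (N₁ N₂ : ℕ) (c d : ℤ → ℝ → ℂ) (k : ℤ) (t : ℝ) :
    spatialCoeff (fun t x => deriv (fun y : ℝ =>
        littlewoodPaley N₁ c t y * conj (littlewoodPaley N₂ d t y)) x) k t =
      Complex.I * k / (2 * Real.pi) *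
        ∑ p ∈ block N₁ ×ˢ block N₂ with p.1 - p.2 = k, c p.1 t * conj (d p.2 t) := by
  have h : ∀ t : ℝ, (fun x : ℝ => littlewoodPaley N₁ c t x * conj (littlewoodPaley N₂ d t x)) =
      fun x : ℝ => ∑ p ∈ block N₁ ×ˢ block N₂,
      (1 / (2 * Real.pi) * (1 / (2 * Real.pi)) * (c p.1 t * conj (d p.2 t))) *
        Complex.exp (Complex.I * (p.1 - p.2 : ℤ) * x) := by
    intro t
    funext x
    simp only [littlewoodPaley, map_mul, map_sum, Finset.mul_sum, Finset.sum_mul,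
      Finset.sum_product]
    rw [Finset.sum_comm]
    refine Finset.sum_congr rfl fun i _ => Finset.sum_congr rfl fun j _ => ?_
    have e : Complex.exp (Complex.I * (i - j : ℤ) * x) =
        Complex.exp (Complex.I * i * x) * conj (Complex.exp (Complex.I * j * x)) := by
      rw [← Complex.exp_conj, ← Complex.exp_add]; congr 1
      simp only [map_mul, Complex.conj_I, Complex.conj_ofReal, map_intCast]
      push_cast; ring
    have e2 : conj (1 / (2 * (Real.pi : ℂ))) = 1 / (2 * (Real.pi : ℂ)) := by
      simp only [map_div₀, map_one, map_mul, Complex.conj_ofReal, map_ofNat]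
    rw [e, e2]; ring
  have h' : (fun t x => deriv (fun y : ℝ =>
        littlewoodPaley N₁ c t y * conj (littlewoodPaley N₂ d t y)) x) =
      fun (t x : ℝ) => ∑ p ∈ block N₁ ×ˢ block N₂,
      (1 / (2 * Real.pi) * (1 / (2 * Real.pi)) * (c p.1 t * conj (d p.2 t)) *
        (Complex.I * (p.1 - p.2 : ℤ))) *
        Complex.exp (Complex.I * (p.1 - p.2 : ℤ) * x) := by
    funext t x
    rw [h t]
    refine HasDerivAt.deriv (HasDerivAt.fun_sum fun p _ => ?_)
    have h1 : HasDerivAt (fun y : ℝ => Complex.I * (p.1 - p.2 : ℤ) * (y : ℂ))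
        (Complex.I * (p.1 - p.2 : ℤ)) x := by
      simpa using (Complex.ofRealCLM.hasDerivAt (x := x)).const_mul
        (Complex.I * (p.1 - p.2 : ℤ))
    convert! h1.cexp.const_mul
      (1 / (2 * Real.pi) * (1 / (2 * Real.pi)) * (c p.1 t * conj (d p.2 t))) using 1
    ring
  rw [h', spatialCoeff_trigPoly]
  have hpi : (Real.pi : ℂ) ≠ 0 := Complex.ofReal_ne_zero.2 Real.pi_ne_zero
  rw [Finset.mul_sum, Finset.mul_sum]
  -- On the fibre `p.1 - p.2 = k` the factor produced by the derivative is the constant `ik`.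
  refine Finset.sum_congr rfl fun p hp => ?_
  rw [(Finset.mem_filter.1 hp).2]
  field_simp

/-! ### Pointwise bounds of the nonlinearities by convolutions on `ℤ × ℝ`. -/

/-- The space-time frequency space `ℤ × ℝ` carries counting measure times Lebesgue measure. -/
noncomputable abbrev freqMeasure : Measure (ℤ × ℝ) :=
  (Measure.count : Measure ℤ).prod (volume : Measure ℝ)

/-- The absolute value of the space-time Fourier transform, cut off to the block of size `N`. -/
noncomputable def blockFourier (N : ℕ) (u : SpaceTime) (x : ℤ × ℝ) : ℝ≥0∞ :=
  if x.1 ∈ block N then ‖u.fourier x.1 x.2‖ₑ else 0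

lemma measurable_spaceTime_fourier (u : SpaceTime) (k : ℤ) : Measurable (u.fourier k) := by
  unfold SpaceTime.fourier
  exact (Lp.stronglyMeasurable _).measurable.comp (by fun_prop)

lemma measurable_blockFourier (N : ℕ) (u : SpaceTime) : Measurable (blockFourier N u) := by
  refine measurable_from_prod_countable_right fun k => ?_
  by_cases hk : k ∈ block N <;> simp only [blockFourier, hk, if_true, if_false]
  · exact (measurable_spaceTime_fourier u k).enorm
  · exact measurable_const

lemma lintegral_freqMeasure {f : ℤ × ℝ → ℝ≥0∞} (hf : Measurable f) :
    ∫⁻ x, f x ∂freqMeasure = ∑' k : ℤ, ∫⁻ τ : ℝ, f (k, τ) := by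
  rw [lintegral_prod _ hf.aemeasurable, lintegral_count]

lemma exp_neg_eq_timeChar (τ t : ℝ) :
    Complex.exp (-(Complex.I * τ * t)) = timeChar (τ / (2 * Real.pi)) t := by
  unfold timeChar
  congr 1
  rw [show 2 * Real.pi * (τ / (2 * Real.pi)) * t = τ * t by field_simp]
  push_cast; ring

/-- The substitution `η = τ/2π` has Jacobian `2π ≥ 1`. An inequality is enough, since all constants
end up in `K`. -/
lemma lintegral_le_lintegral_comp_div_two_pi {F : ℝ → ℝ≥0∞} (hF : Measurable F) :
    ∫⁻ η, F η ≤ ∫⁻ τ, F (τ / (2 * Real.pi)) := by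
  have hpi : (0 : ℝ) < (2 * Real.pi)⁻¹ := by positivity
  have h := lintegral_map (μ := volume) hF (g := fun τ : ℝ => (2 * Real.pi)⁻¹ * τ) (by fun_prop)
  rw [Real.map_volume_mul_left hpi.ne', lintegral_smul_measure, inv_inv,
    abs_of_pos (by positivity)] at h
  simp_rw [div_eq_inv_mul]
  rw [← h, smul_eq_mul]
  refine le_mul_of_one_le_left' ?_
  rw [ENNReal.one_le_ofReal]
  linarith [Real.pi_gt_three]

lemma enorm_one_div_two_pi_le : ‖(1 / (2 * Real.pi) : ℂ)‖ₑ ≤ 1 := by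
  rw [← ofReal_norm, ENNReal.ofReal_le_one, norm_div, norm_mul, norm_one,
    Complex.norm_real, Real.norm_of_nonneg Real.pi_pos.le, Complex.norm_ofNat]
  rw [div_le_one (by positivity)]
  linarith [Real.pi_gt_three]

lemma integrable_timeChar_mul_mul {f g : ℝ → ℂ} (hf : MemLp f 2) (hg : MemLp g 2) (ξ : ℝ) :
    Integrable fun t => timeChar ξ t * (f t * g t) :=
  (hf.integrable_mul hg).bdd_mul (c := 1) (continuous_timeChar ξ).aestronglyMeasurable
    (Filter.Eventually.of_forall fun t => (norm_timeChar ξ t).le)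

lemma enorm_integral_timeChar_mul_le (u v : SpaceTime) (k l : ℤ) (τ : ℝ) :
    ‖∫ t, timeChar (τ / (2 * Real.pi)) t * (u.coeff k t * v.coeff l t)‖ₑ ≤
      ∫⁻ τ' : ℝ, ‖u.fourier k τ'‖ₑ * ‖v.fourier l (τ - τ')‖ₑ := by
  unfold SpaceTime.coeff
  rw [integral_timeChar_mul_mul]
  refine (enorm_integral_le_lintegral_enorm _).trans ?_
  refine (lintegral_le_lintegral_comp_div_two_pi ?_).trans (le_of_eq ?_)
  · exact ((Lp.stronglyMeasurable _).measurable.mul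
      ((Lp.stronglyMeasurable _).measurable.comp (by fun_prop))).enorm
  · refine lintegral_congr fun τ' => ?_
    rw [enorm_mul, SpaceTime.fourier, SpaceTime.fourier, sub_div]

lemma enorm_integral_timeChar_mul_conj_le (u v : SpaceTime) (k l : ℤ) (τ : ℝ) :
    ‖∫ t, timeChar (τ / (2 * Real.pi)) t * (u.coeff k t * conj (v.coeff l t))‖ₑ ≤
      ∫⁻ τ' : ℝ, ‖u.fourier k τ'‖ₑ * ‖v.fourier l (τ' - τ)‖ₑ := by
  unfold SpaceTime.coeff
  rw [integral_timeChar_mul_mul_conj]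
  refine (enorm_integral_le_lintegral_enorm _).trans ?_
  refine (lintegral_le_lintegral_comp_div_two_pi ?_).trans (le_of_eq ?_)
  · exact ((Lp.stronglyMeasurable _).measurable.mul (Complex.continuous_conj.measurable.comp
      ((Lp.stronglyMeasurable _).measurable.comp (by fun_prop)))).enorm
  · refine lintegral_congr fun τ' => ?_
    rw [enorm_mul, SpaceTime.fourier, SpaceTime.fourier, sub_div, RCLike.enorm_conj]

theorem enorm_spaceTimeFourier_schrodingerTerm_le (N₀ N₁ N₂ : ℕ) (u v : SpaceTime) (k : ℤ)
    (τ : ℝ) :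
    ‖spaceTimeFourier (schrodingerTerm N₀ N₁ N₂ u v) k τ‖ₑ ≤ if k ∈ block N₀ then
      ∫⁻ y, blockFourier N₁ u y * blockFourier N₂ v ((k, τ) - y) ∂freqMeasure else 0 := by
  unfold spaceTimeFourier schrodingerTerm
  simp_rw [spatialCoeff_littlewoodPaley, spatialCoeff_mul_littlewoodPaley, exp_neg_eq_timeChar]
  split_ifs with hk
  swap
  · simp
  have h1 : ∀ t : ℝ, timeChar (τ / (2 * Real.pi)) t * (1 / (2 * Real.pi) *
      ∑ p ∈ block N₁ ×ˢ block N₂ with p.1 + p.2 = k, u.coeff p.1 t * v.coeff p.2 t) =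
      1 / (2 * Real.pi) * ∑ p ∈ block N₁ ×ˢ block N₂ with p.1 + p.2 = k,
        timeChar (τ / (2 * Real.pi)) t * (u.coeff p.1 t * v.coeff p.2 t) := fun t => by
    rw [← Finset.mul_sum]; ring
  simp_rw [h1]
  rw [integral_const_mul, integral_finsetSum _ fun p _ =>
    integrable_timeChar_mul_mul (Lp.memLp (u p.1)) (Lp.memLp (v p.2)) _, enorm_mul]
  refine (mul_le_of_le_one_left' enorm_one_div_two_pi_le).trans ((enorm_sum_le _ _).trans ?_)
  have hm : Measurable fun y => blockFourier N₁ u y * blockFourier N₂ v ((k, τ) - y) :=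
    (measurable_blockFourier N₁ u).mul
      ((measurable_blockFourier N₂ v).comp (measurable_const.sub measurable_id))
  rw [lintegral_freqMeasure hm]
  set Φ : ℤ → ℝ≥0∞ := fun j => ∫⁻ τ' : ℝ,
    blockFourier N₁ u (j, τ') * blockFourier N₂ v ((k, τ) - (j, τ')) with hΦ
  have h2 : ∀ p ∈ {p ∈ block N₁ ×ˢ block N₂ | p.1 + p.2 = k},
      ‖∫ t, timeChar (τ / (2 * Real.pi)) t * (u.coeff p.1 t * v.coeff p.2 t)‖ₑ ≤ Φ p.1 := by
    rintro ⟨i, j⟩ hp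
    simp only [Finset.mem_filter, Finset.mem_product] at hp
    obtain ⟨⟨hi, hj⟩, rfl⟩ := hp
    refine (enorm_integral_timeChar_mul_le u v i j τ).trans (le_of_eq ?_)
    refine lintegral_congr fun τ' => ?_
    simp [blockFourier, hi, hj]
  refine (Finset.sum_le_sum h2).trans ?_
  -- On `p.1 + p.2 = k` the first entry determines the pair, so the finite sum is part of the series
  -- over all `j`.
  rw [← Finset.sum_image (f := Φ) (g := Prod.fst)]
  · exact ENNReal.sum_le_tsum _
  · rintro ⟨i, j⟩ hp ⟨i', j'⟩ hp' h
    simp only [Finset.coe_filter, Set.mem_ofPred_eq] at hp hp' h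
    ext
    · exact h
    · simp only; linarith [hp.2, hp'.2]

theorem enorm_spaceTimeFourier_waveTerm_le (N₀ N₁ N₂ : ℕ) (u v : SpaceTime) (k : ℤ) (τ : ℝ) :
    ‖spaceTimeFourier (waveTerm N₀ N₁ N₂ u v) k τ‖ₑ ≤ if k ∈ block N₀ then
      ENNReal.ofReal |(k : ℝ)| * ∫⁻ x, blockFourier N₁ u x * blockFourier N₂ v (x - (k, τ))
        ∂freqMeasure else 0 := by
  unfold spaceTimeFourier waveTerm
  simp_rw [spatialCoeff_littlewoodPaley, spatialCoeff_deriv_mul_conj_littlewoodPaley,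
    exp_neg_eq_timeChar]
  split_ifs with hk
  swap
  · simp
  have h1 : ∀ t : ℝ, timeChar (τ / (2 * Real.pi)) t * (Complex.I * k / (2 * Real.pi) *
      ∑ p ∈ block N₁ ×ˢ block N₂ with p.1 - p.2 = k, u.coeff p.1 t * conj (v.coeff p.2 t)) =
      (Complex.I * k * (1 / (2 * Real.pi))) * ∑ p ∈ block N₁ ×ˢ block N₂ with p.1 - p.2 = k,
        timeChar (τ / (2 * Real.pi)) t * (u.coeff p.1 t * conj (v.coeff p.2 t)) := fun t => by
    rw [← Finset.mul_sum]; ring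
  simp_rw [h1]
  rw [integral_const_mul, integral_finsetSum _ fun p _ =>
    integrable_timeChar_mul_mul (Lp.memLp (u p.1)) (Lp.memLp (v p.2)).star _, enorm_mul]
  have h3 : ‖Complex.I * k * (1 / (2 * Real.pi))‖ₑ ≤ ENNReal.ofReal |(k : ℝ)| := by
    rw [enorm_mul]
    refine (mul_le_of_le_one_right' enorm_one_div_two_pi_le).trans (le_of_eq ?_)
    rw [← ofReal_norm, norm_mul, Complex.norm_I, one_mul, Complex.norm_intCast]
  refine mul_le_mul' h3 ((enorm_sum_le _ _).trans ?_)
  have hm : Measurable fun x => blockFourier N₁ u x * blockFourier N₂ v (x - (k, τ)) :=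
    (measurable_blockFourier N₁ u).mul
      ((measurable_blockFourier N₂ v).comp (measurable_id.sub measurable_const))
  rw [lintegral_freqMeasure hm]
  set Φ : ℤ → ℝ≥0∞ := fun j => ∫⁻ τ' : ℝ,
    blockFourier N₁ u (j, τ') * blockFourier N₂ v ((j, τ') - (k, τ)) with hΦ
  have h2 : ∀ p ∈ {p ∈ block N₁ ×ˢ block N₂ | p.1 - p.2 = k},
      ‖∫ t, timeChar (τ / (2 * Real.pi)) t * (u.coeff p.1 t * conj (v.coeff p.2 t))‖ₑ ≤
        Φ p.1 := by
    rintro ⟨i, j⟩ hp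
    simp only [Finset.mem_filter, Finset.mem_product] at hp
    obtain ⟨⟨hi, hj⟩, rfl⟩ := hp
    refine (enorm_integral_timeChar_mul_conj_le u v i j τ).trans (le_of_eq ?_)
    refine lintegral_congr fun τ' => ?_
    simp [blockFourier, hi, hj]
  refine (Finset.sum_le_sum h2).trans ?_
  rw [← Finset.sum_image (f := Φ) (g := Prod.fst)]
  · exact ENNReal.sum_le_tsum _
  · rintro ⟨i, j⟩ hp ⟨i', j'⟩ hp' h
    simp only [Finset.coe_filter, Set.mem_ofPred_eq] at hp hp' h
    ext
    · exact h
    · simp only; linarith [hp.2, hp'.2]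

/-- This allows the substitution `y ↦ x - y` in integrals over frequency space. -/
instance : (freqMeasure).IsNegInvariant :=
  ⟨((Measure.measurePreserving_neg (Measure.count : Measure ℤ)).prod
    (Measure.measurePreserving_neg (volume : Measure ℝ))).map_eq⟩

/-! ### `L²` duality and Cauchy-Schwarz for trilinear forms. -/

section Abstract

variable {X Y : Type*} [MeasurableSpace X] [MeasurableSpace Y]

/-- The `L²` norm of a nonnegative function. -/
noncomputable def l2norm (μ : Measure X) (f : X → ℝ≥0∞) : ℝ≥0∞ :=
  (∫⁻ x, f x ^ 2 ∂μ) ^ (1 / 2 : ℝ)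

lemma l2norm_sq (μ : Measure X) (f : X → ℝ≥0∞) : l2norm μ f ^ 2 = ∫⁻ x, f x ^ 2 ∂μ := by
  rw [l2norm, ← ENNReal.rpow_natCast, ← ENNReal.rpow_mul]
  norm_num

lemma sqrt_sq_ennreal (a : ℝ≥0∞) : (a ^ 2) ^ (1 / 2 : ℝ) = a := by
  rw [← ENNReal.rpow_natCast, ← ENNReal.rpow_mul]
  norm_num

lemma l2norm_mono {μ : Measure X} {f g : X → ℝ≥0∞} (h : ∀ x, f x ≤ g x) :
    l2norm μ f ≤ l2norm μ g :=
  ENNReal.rpow_le_rpow (lintegral_mono fun x => by gcongr; exact h x) (by norm_num)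

lemma lintegral_mul_le_l2norm {μ : Measure X} {f g : X → ℝ≥0∞} (hf : Measurable f)
    (hg : Measurable g) : ∫⁻ x, f x * g x ∂μ ≤ l2norm μ f * l2norm μ g := by
  simpa [l2norm] using ENNReal.lintegral_mul_le_Lp_mul_Lq μ Real.HolderConjugate.two_two
    hf.aemeasurable hg.aemeasurable

lemma l2norm_const_mul {μ : Measure X} {f : X → ℝ≥0∞} (hf : Measurable f) (c : ℝ≥0∞) :
    l2norm μ (fun x => c * f x) = c * l2norm μ f := by
  simp_rw [l2norm, mul_pow]
  rw [lintegral_const_mul _ (hf.pow_const _), ENNReal.mul_rpow_of_nonneg _ _ (by norm_num),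
    sqrt_sq_ennreal]

/-- Duality for the `L²` norm of a nonnegative function. -/
theorem l2norm_le_of_forall_lintegral_mul_le (μ : Measure X) [SigmaFinite μ]
    {F : X → ℝ≥0∞} (hF : Measurable F) {A : ℝ≥0∞}
    (h : ∀ f : X → ℝ≥0∞, Measurable f → ∫⁻ x, f x * F x ∂μ ≤ A * l2norm μ f) :
    l2norm μ F ≤ A := by
  -- Cutting `F` off in height and to sets of finite measure makes its norm finite, so that it can
  -- be cancelled after testing against the truncation; monotone convergence removes the cutoff.
  let f : ℕ → X → ℝ≥0∞ := fun n => (spanningSets μ n).indicator fun x => min (F x) n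
  have hfm : ∀ n, Measurable (f n) := fun n =>
    (hF.min measurable_const).indicator (measurableSet_spanningSets μ n)
  have hle : ∀ n x, f n x ≤ F x := fun n x => by
    by_cases hx : x ∈ spanningSets μ n <;> simp [f, hx]
  have hfin : ∀ n, l2norm μ (f n) ≠ ∞ := fun n => by
    have : ∫⁻ x, f n x ^ 2 ∂μ ≤ ∫⁻ x, (spanningSets μ n).indicator (fun _ => (n : ℝ≥0∞) ^ 2) x ∂μ := by
      refine lintegral_mono fun x => ?_
      by_cases hx : x ∈ spanningSets μ n <;> simp only [f, hx, Set.indicator_of_mem,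
        Set.indicator_of_notMem, not_false_eq_true]
      · gcongr
        exact min_le_right _ _
      · simp
    rw [lintegral_indicator_const (measurableSet_spanningSets μ n)] at this
    refine ENNReal.rpow_ne_top_of_nonneg (by norm_num) (ne_top_of_le_ne_top ?_ this)
    exact ENNReal.mul_ne_top (by finiteness) (measure_spanningSets_lt_top μ n).ne
  have hA : ∀ n, l2norm μ (f n) ≤ A := fun n => by
    by_cases h0 : l2norm μ (f n) = 0
    · simp [h0]
    · have h1 : l2norm μ (f n) * l2norm μ (f n) ≤ A * l2norm μ (f n) := by
        rw [← sq, l2norm_sq]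
        refine le_trans (lintegral_mono fun x => ?_) (h (f n) (hfm n))
        rw [sq]
        gcongr
        exact hle n x
      exact (ENNReal.mul_le_mul_iff_left h0 (hfin n)).1 h1
  have hmono : Monotone fun n x => f n x ^ 2 := by
    intro m n hmn x
    simp only
    gcongr
    refine Set.indicator_le_indicator_of_subset (monotone_spanningSets μ hmn) (fun _ => zero_le)
      x |>.trans (Set.indicator_le_indicator ?_)
    gcongr
  have hsup : ∀ x, ⨆ n, f n x ^ 2 = F x ^ 2 := by
    intro x
    refine le_antisymm (iSup_le fun n => by gcongr; exact hle n x) ?_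
    have ht : Filter.Tendsto (fun n => f n x) Filter.atTop (nhds (F x)) := by
      have h1 : ∀ᶠ n : ℕ in Filter.atTop, min (F x) (n : ℝ≥0∞) = f n x := by
        filter_upwards [Filter.eventually_ge_atTop (spanningSetsIndex μ x)] with n hn
        have : x ∈ spanningSets μ n := mem_spanningSets_of_index_le μ x hn
        simp [f, this]
      refine Filter.Tendsto.congr' h1 ?_
      have h2 := (tendsto_const_nhds (x := F x)).min ENNReal.tendsto_nat_nhds_top
      simpa using h2
    have ht2 := ((ENNReal.continuous_pow 2).tendsto (F x)).comp ht
    exact le_of_tendsto' ht2 fun n =>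
      le_iSup (fun m => f m x ^ 2) n
  have hsq : ∫⁻ x, F x ^ 2 ∂μ ≤ A ^ 2 := by
    simp_rw [← hsup]
    rw [lintegral_iSup (fun n => (hfm n).pow_const 2) hmono]
    refine iSup_le fun n => ?_
    rw [← l2norm_sq]
    gcongr
    exact hA n
  calc l2norm μ F ≤ (A ^ 2) ^ (1 / 2 : ℝ) := ENNReal.rpow_le_rpow hsq (by norm_num)
    _ = A := sqrt_sq_ennreal A

/-- Cauchy-Schwarz in `y`, where the kernel costs at most `S` uniformly in `x`, followed by
Cauchy-Schwarz in `x`. -/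
theorem lintegral_lintegral_mul_le (μ : Measure X) (ν : Measure Y) [SFinite ν] [SFinite μ]
    {F : X → ℝ≥0∞} {P K : X → Y → ℝ≥0∞} (hF : Measurable F)
    (hP : Measurable (Function.uncurry P)) (hK : Measurable (Function.uncurry K)) {S : ℝ≥0∞}
    (hS : ∀ x, ∫⁻ y, K x y ^ 2 ∂ν ≤ S ^ 2) :
    ∫⁻ x, F x * ∫⁻ y, P x y * K x y ∂ν ∂μ ≤
      S * (l2norm μ F * (∫⁻ x, ∫⁻ y, P x y ^ 2 ∂ν ∂μ) ^ (1 / 2 : ℝ)) := by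
  have hP' : ∀ x, Measurable (P x) := fun x => hP.comp measurable_prodMk_left
  have hK' : ∀ x, Measurable (K x) := fun x => hK.comp measurable_prodMk_left
  have hPm : Measurable fun x => l2norm ν (P x) :=
    ((hP.pow_const 2).lintegral_prod_right' (ν := ν)).pow_const _
  calc ∫⁻ x, F x * ∫⁻ y, P x y * K x y ∂ν ∂μ
      ≤ ∫⁻ x, S * (F x * l2norm ν (P x)) ∂μ := by
        refine lintegral_mono fun x => ?_
        have h1 : l2norm ν (K x) ≤ S := by
          rw [← sqrt_sq_ennreal S]
          exact ENNReal.rpow_le_rpow (hS x) (by norm_num)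
        calc F x * ∫⁻ y, P x y * K x y ∂ν ≤ F x * (l2norm ν (P x) * S) := by
              gcongr
              exact (lintegral_mul_le_l2norm (hP' x) (hK' x)).trans (by gcongr)
          _ = S * (F x * l2norm ν (P x)) := by ring
    _ = S * ∫⁻ x, F x * l2norm ν (P x) ∂μ := lintegral_const_mul _ (hF.mul hPm)
    _ ≤ _ := by
        gcongr
        refine (lintegral_mul_le_l2norm hF hPm).trans (le_of_eq ?_)
        rw [l2norm, l2norm]
        simp_rw [l2norm_sq]

lemma sqrt_lintegral_prod_eq {G : Type*} [MeasurableSpace G] (μ : Measure G)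
    {g h : G → ℝ≥0∞} (hg : Measurable g)
    {Q : G → G → ℝ≥0∞}
    (hQ : ∀ x, ∫⁻ y, Q x y ^ 2 ∂μ = l2norm μ h ^ 2) (hQm : ∀ x, Measurable (Q x)) :
    (∫⁻ x, ∫⁻ y, (g x * Q x y) ^ 2 ∂μ ∂μ) ^ (1 / 2 : ℝ) = l2norm μ g * l2norm μ h := by
  simp_rw [mul_pow]
  have : ∀ x, ∫⁻ y, g x ^ 2 * Q x y ^ 2 ∂μ = g x ^ 2 * l2norm μ h ^ 2 := fun x => by
    rw [lintegral_const_mul _ ((hQm x).pow_const 2), hQ]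
  simp_rw [this]
  rw [lintegral_mul_const _ (hg.pow_const 2), ← l2norm_sq, ← mul_pow, sqrt_sq_ennreal]

lemma lintegral_lintegral_const_mul_add₃ (μ : Measure X) (ν : Measure Y) [SFinite ν]
    {F₁ F₂ F₃ : X → Y → ℝ≥0∞} (h₁ : Measurable (Function.uncurry F₁))
    (h₂ : Measurable (Function.uncurry F₂)) (h₃ : Measurable (Function.uncurry F₃)) (c : ℝ≥0∞) :
    ∫⁻ x, ∫⁻ y, c * (F₁ x y + F₂ x y + F₃ x y) ∂ν ∂μ =
      c * (∫⁻ x, ∫⁻ y, F₁ x y ∂ν ∂μ + ∫⁻ x, ∫⁻ y, F₂ x y ∂ν ∂μ + ∫⁻ x, ∫⁻ y, F₃ x y ∂ν ∂μ) := by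
  have i₁ : Measurable fun x => ∫⁻ y, F₁ x y ∂ν := h₁.lintegral_prod_right'
  have i₂ : Measurable fun x => ∫⁻ y, F₂ x y ∂ν := h₂.lintegral_prod_right'
  have i₃ : Measurable fun x => ∫⁻ y, F₃ x y ∂ν := h₃.lintegral_prod_right'
  have h : ∀ x, ∫⁻ y, c * (F₁ x y + F₂ x y + F₃ x y) ∂ν =
      c * (∫⁻ y, F₁ x y ∂ν + ∫⁻ y, F₂ x y ∂ν + ∫⁻ y, F₃ x y ∂ν) := fun x => by
    have j₁ : Measurable (F₁ x) := h₁.comp measurable_prodMk_left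
    have j₂ : Measurable (F₂ x) := h₂.comp measurable_prodMk_left
    have j₃ : Measurable (F₃ x) := h₃.comp measurable_prodMk_left
    rw [lintegral_const_mul _ (by fun_prop), lintegral_add_left (by fun_prop),
      lintegral_add_left (by fun_prop)]
  simp_rw [h]
  rw [lintegral_const_mul _ (by fun_prop), lintegral_add_left (by fun_prop),
    lintegral_add_left (by fun_prop)]

end Abstract

section Group

variable {G : Type*} [AddCommGroup G] [MeasurableSpace G] [MeasurableAdd₂ G] [MeasurableNeg G]
  (μ : Measure G) [SFinite μ] [μ.IsAddLeftInvariant]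
  {f g h : G → ℝ≥0∞} {K : G → G → ℝ≥0∞}

/-- A trilinear convolution form with a kernel that is square integrable in `y`. -/
theorem lintegral_convolution_kernel_le_left (hf : Measurable f) (hg : Measurable g)
    (hh : Measurable h) (hK : Measurable (Function.uncurry K)) {S : ℝ≥0∞}
    (hS : ∀ x, ∫⁻ y, K x y ^ 2 ∂μ ≤ S ^ 2) :
    ∫⁻ x, ∫⁻ y, f x * g y * h (x - y) * K x y ∂μ ∂μ ≤
      S * (l2norm μ f * l2norm μ g * l2norm μ h) := by
  have hP : Measurable (Function.uncurry fun x y => g y * h (x - y)) := by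
    unfold Function.uncurry; fun_prop
  have h1 : ∀ x, ∫⁻ y, f x * g y * h (x - y) * K x y ∂μ =
      f x * ∫⁻ y, (g y * h (x - y)) * K x y ∂μ := fun x => by
    rw [← lintegral_const_mul _ (f := fun y => (g y * h (x - y)) * K x y)
      ((hP.mul hK).comp measurable_prodMk_left)]
    exact lintegral_congr fun y => by ring
  simp_rw [h1]
  refine (lintegral_lintegral_mul_le μ μ hf hP hK hS).trans (le_of_eq ?_)
  rw [lintegral_lintegral_swap (hP.pow_const 2).aemeasurable,
    sqrt_lintegral_prod_eq μ hg (Q := fun y x => h (x - y)) (h := h) _ (fun y => by fun_prop),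
    mul_assoc]
  intro y
  rw [l2norm_sq, lintegral_sub_right_eq_self (fun x => h x ^ 2)]

/-- A trilinear convolution form with a kernel that is square integrable in `x`. -/
theorem lintegral_convolution_kernel_le_right [μ.IsNegInvariant] (hf : Measurable f)
    (hg : Measurable g)
    (hh : Measurable h) (hK : Measurable (Function.uncurry K)) {S : ℝ≥0∞}
    (hS : ∀ y, ∫⁻ x, K x y ^ 2 ∂μ ≤ S ^ 2) :
    ∫⁻ x, ∫⁻ y, f x * g y * h (x - y) * K x y ∂μ ∂μ ≤
      S * (l2norm μ f * l2norm μ g * l2norm μ h) := by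
  have hP : Measurable (Function.uncurry fun y x => f x * h (x - y)) := by
    unfold Function.uncurry; fun_prop
  have hK' : Measurable (Function.uncurry fun y x => K x y) := hK.comp measurable_swap
  rw [lintegral_lintegral_swap]
  swap
  · have : Measurable (Function.uncurry fun x y => f x * g y * h (x - y)) := by
      unfold Function.uncurry; fun_prop
    exact (this.mul hK).aemeasurable
  have h1 : ∀ y, ∫⁻ x, f x * g y * h (x - y) * K x y ∂μ =
      g y * ∫⁻ x, (f x * h (x - y)) * K x y ∂μ := fun y => by
    rw [← lintegral_const_mul _ (f := fun x => (f x * h (x - y)) * K x y)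
      ((hP.mul hK').comp measurable_prodMk_left)]
    exact lintegral_congr fun x => by ring
  simp_rw [h1]
  refine (lintegral_lintegral_mul_le μ μ hg hP hK' hS).trans (le_of_eq ?_)
  rw [lintegral_lintegral_swap (hP.pow_const 2).aemeasurable,
    sqrt_lintegral_prod_eq μ hf (Q := fun x y => h (x - y)) (h := h) _ (fun x => by fun_prop)]
  · ring
  intro x
  rw [l2norm_sq, lintegral_sub_left_eq_self (fun y => h y ^ 2)]

/-- A trilinear convolution form with a kernel that is square integrable along `x - y = z`. -/
theorem lintegral_convolution_kernel_le_diag (hf : Measurable f) (hg : Measurable g)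
    (hh : Measurable h) (hK : Measurable (Function.uncurry K)) {S : ℝ≥0∞}
    (hS : ∀ z, ∫⁻ y, K (y + z) y ^ 2 ∂μ ≤ S ^ 2) :
    ∫⁻ x, ∫⁻ y, f x * g y * h (x - y) * K x y ∂μ ∂μ ≤
      S * (l2norm μ f * l2norm μ g * l2norm μ h) := by
  have hP : Measurable (Function.uncurry fun z y => f (y + z) * g y) := by
    unfold Function.uncurry; fun_prop
  have hK' : Measurable (Function.uncurry fun z y => K (y + z) y) :=
    hK.comp (show Measurable fun p : G × G => (p.2 + p.1, p.2) by fun_prop)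
  have hT : Measurable (Function.uncurry fun x y => f x * g y * h (x - y) * K x y) := by
    have : Measurable (Function.uncurry fun x y => f x * g y * h (x - y)) := by
      unfold Function.uncurry; fun_prop
    exact this.mul hK
  rw [lintegral_lintegral_swap hT.aemeasurable]
  -- Substituting `x = y + z` and then exchanging the integrals makes the difference `z` the outer
  -- variable, the one held fixed in `hS`.
  have h0 : ∀ y, ∫⁻ x, f x * g y * h (x - y) * K x y ∂μ =
      ∫⁻ z, f (y + z) * g y * h z * K (y + z) y ∂μ := fun y => by
    rw [← lintegral_add_left_eq_self _ y]
    simp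
  simp_rw [h0]
  rw [lintegral_lintegral_swap]
  swap
  · have := hT.comp (show Measurable fun p : G × G => (p.1 + p.2, p.1) by fun_prop)
    refine Measurable.aemeasurable ?_
    convert! this using 1
    funext p
    simp [Function.uncurry]
  have h1 : ∀ z, ∫⁻ y, f (y + z) * g y * h z * K (y + z) y ∂μ =
      h z * ∫⁻ y, (f (y + z) * g y) * K (y + z) y ∂μ := fun z => by
    rw [← lintegral_const_mul _ (f := fun y => (f (y + z) * g y) * K (y + z) y)
      ((hP.mul hK').comp measurable_prodMk_left)]
    exact lintegral_congr fun y => by ring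
  simp_rw [h1]
  refine (lintegral_lintegral_mul_le μ μ hh hP hK' hS).trans (le_of_eq ?_)
  rw [lintegral_lintegral_swap (hP.pow_const 2).aemeasurable]
  simp_rw [mul_comm (f _) (g _)]
  rw [sqrt_lintegral_prod_eq μ hg (Q := fun y z => f (y + z)) (h := f) _ (fun y => by fun_prop)]
  · ring
  intro y
  rw [l2norm_sq, lintegral_add_left_eq_self (fun z => f z ^ 2)]

end Group

/-! ### Bracket weights, their convolutions and their sums. -/

section Bracket

lemma one_le_bracket (x : ℝ) : 1 ≤ bracket x := by
  unfold bracket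
  rw [Real.one_le_sqrt]
  nlinarith [sq_nonneg x]

lemma bracket_pos (x : ℝ) : 0 < bracket x := one_pos.trans_le (one_le_bracket x)

lemma bracket_neg (x : ℝ) : bracket (-x) = bracket x := by simp [bracket]

lemma bracket_abs (x : ℝ) : bracket |x| = bracket x := by simp [bracket]

lemma abs_le_bracket (x : ℝ) : |x| ≤ bracket x := by
  unfold bracket
  exact Real.abs_le_sqrt (by linarith)

lemma bracket_le_one_add_abs (x : ℝ) : bracket x ≤ 1 + |x| := by
  unfold bracket
  rw [Real.sqrt_le_left (by positivity)]
  nlinarith [abs_nonneg x, sq_abs x]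

lemma one_add_abs_le_two_mul_bracket (x : ℝ) : 1 + |x| ≤ 2 * bracket x := by
  linarith [one_le_bracket x, abs_le_bracket x]

lemma bracket_sub_le (x y : ℝ) : bracket (x - y) ≤ bracket x + bracket y := by
  have hx := abs_le_bracket x
  have hy := abs_le_bracket y
  have hx2 : bracket x ^ 2 = 1 + x ^ 2 := Real.sq_sqrt (by positivity)
  have hy2 : bracket y ^ 2 = 1 + y ^ 2 := Real.sq_sqrt (by positivity)
  rw [bracket, Real.sqrt_le_left (by linarith [bracket_pos x, bracket_pos y])]
  have h1 : |x| * |y| ≤ bracket x * bracket y := by gcongr; exact (bracket_pos x).le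
  have h2 : -(x * y) ≤ |x| * |y| := by rw [← abs_mul]; exact neg_le_abs _
  nlinarith

lemma continuous_bracket : Continuous bracket := by
  unfold bracket
  fun_prop

/-- The weight `⟨x⟩^r`, valued in `[0, ∞]`. -/
noncomputable def weight (r x : ℝ) : ℝ≥0∞ := ENNReal.ofReal (bracket x ^ r)

lemma measurable_weight (r : ℝ) : Measurable (weight r) :=
  (continuous_bracket.measurable.pow_const r).ennreal_ofReal

lemma weight_mul (r s x : ℝ) : weight r x * weight s x = weight (r + s) x := by
  rw [weight, weight, weight, ← ENNReal.ofReal_mul (Real.rpow_nonneg (bracket_pos x).le _),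
    Real.rpow_add (bracket_pos x)]

lemma weight_zero (x : ℝ) : weight 0 x = 1 := by simp [weight]

lemma weight_sq (r x : ℝ) : weight r x ^ 2 = weight (2 * r) x := by
  rw [sq, weight_mul, two_mul]

lemma weight_neg_mul (r x : ℝ) : weight (-r) x * weight r x = 1 := by
  rw [weight_mul, neg_add_cancel, weight_zero]

lemma weight_mono {r s : ℝ} (h : r ≤ s) (x : ℝ) : weight r x ≤ weight s x :=
  ENNReal.ofReal_le_ofReal (Real.rpow_le_rpow_of_exponent_le (one_le_bracket x) h)

lemma weight_neg (r x : ℝ) : weight r (-x) = weight r x := by simp [weight, bracket_neg]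

lemma weight_abs (r x : ℝ) : weight r |x| = weight r x := by simp [weight, bracket_abs]

lemma lintegral_weight_lt_top {r : ℝ} (hr : 1 < r) : ∫⁻ x, weight (-r) x < ∞ := by
  have h := finite_integral_one_add_norm (E := ℝ) (μ := volume) (r := r) (by simpa using hr)
  calc ∫⁻ x, weight (-r) x
      ≤ ∫⁻ x, ENNReal.ofReal (2 ^ r) * ENNReal.ofReal ((1 + ‖x‖) ^ (-r)) := by
        refine lintegral_mono fun x => ?_
        rw [← ENNReal.ofReal_mul (by positivity)]
        refine ENNReal.ofReal_le_ofReal ?_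
        have h1 := one_add_abs_le_two_mul_bracket x
        have h2 : (2 * bracket x) ^ (-r) ≤ (1 + |x|) ^ (-r) :=
          Real.rpow_le_rpow_of_nonpos (by positivity) h1 (by linarith)
        rw [Real.mul_rpow (by norm_num) (bracket_pos x).le, Real.rpow_neg (by norm_num)] at h2
        rw [Real.norm_eq_abs]
        calc bracket x ^ (-r) = 2 ^ r * ((2 ^ r)⁻¹ * bracket x ^ (-r)) := by
              rw [mul_inv_cancel_left₀ (by positivity)]
          _ ≤ _ := by gcongr
    _ < ∞ := by
        rw [lintegral_const_mul _ (by fun_prop)]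
        exact ENNReal.mul_lt_top ENNReal.ofReal_lt_top h

lemma lintegral_weight_sub (r p : ℝ) : ∫⁻ x, weight r (x - p) = ∫⁻ x, weight r x :=
  lintegral_sub_right_eq_self _ p

/-- The larger of `a`, `b` is at least `d/2`. Its power -5/8 is spent on `d`, and its remaining
power -1/4 passes to the smaller one, whose exponent becomes -9/8, which is integrable. -/
lemma rpow_mul_rpow_le_of_le_add {a b d : ℝ} (ha : 1 ≤ a) (hb : 1 ≤ b) (hd : 1 ≤ d)
    (h : d ≤ a + b) : a ^ (-(7 / 8) : ℝ) * b ^ (-(7 / 8) : ℝ) ≤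
      2 * d ^ (-(5 / 8) : ℝ) * (a ^ (-(9 / 8) : ℝ) + b ^ (-(9 / 8) : ℝ)) := by
  wlog hab : b ≤ a generalizing a b
  · have := this hb ha (by linarith) (by linarith)
    linarith
  have ha0 : 0 < a := by linarith
  have hb0 : 0 < b := by linarith
  have h1 : a ^ (-(7 / 8) : ℝ) = a ^ (-(5 / 8) : ℝ) * a ^ (-(1 / 4) : ℝ) := by
    rw [← Real.rpow_add ha0]; norm_num
  have h2 : b ^ (-(9 / 8) : ℝ) = b ^ (-(1 / 4) : ℝ) * b ^ (-(7 / 8) : ℝ) := by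
    rw [← Real.rpow_add hb0]; norm_num
  have h3 : a ^ (-(1 / 4) : ℝ) ≤ b ^ (-(1 / 4) : ℝ) :=
    Real.rpow_le_rpow_of_nonpos hb0 hab (by norm_num)
  have h4 : a ^ (-(5 / 8) : ℝ) ≤ 2 * d ^ (-(5 / 8) : ℝ) := by
    have h5 : a ^ (-(5 / 8) : ℝ) ≤ (d / 2) ^ (-(5 / 8) : ℝ) :=
      Real.rpow_le_rpow_of_nonpos (by linarith) (by linarith) (by norm_num)
    rw [Real.div_rpow (by linarith) (by norm_num), Real.rpow_neg (zero_le_two (α := ℝ)),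
      div_inv_eq_mul, mul_comm] at h5
    refine h5.trans ?_
    gcongr
    calc (2 : ℝ) ^ (5 / 8 : ℝ) ≤ 2 ^ (1 : ℝ) :=
          Real.rpow_le_rpow_of_exponent_le (by norm_num) (by norm_num)
      _ = 2 := Real.rpow_one 2
  calc a ^ (-(7 / 8) : ℝ) * b ^ (-(7 / 8) : ℝ)
      = a ^ (-(5 / 8) : ℝ) * (a ^ (-(1 / 4) : ℝ) * b ^ (-(7 / 8) : ℝ)) := by rw [h1]; ring
    _ ≤ a ^ (-(5 / 8) : ℝ) * (b ^ (-(1 / 4) : ℝ) * b ^ (-(7 / 8) : ℝ)) := by gcongr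
    _ = a ^ (-(5 / 8) : ℝ) * b ^ (-(9 / 8) : ℝ) := by rw [h2]
    _ ≤ (2 * d ^ (-(5 / 8) : ℝ)) * (a ^ (-(9 / 8) : ℝ) + b ^ (-(9 / 8) : ℝ)) := by
        gcongr
        have : 0 ≤ a ^ (-(9 / 8) : ℝ) := by positivity
        linarith

/-- The convolution of two weights. -/
theorem lintegral_weight_mul_weight_le (p q : ℝ) :
    ∫⁻ τ, weight (-(7 / 8)) (τ - p) * weight (-(7 / 8)) (τ - q) ≤
      4 * (∫⁻ x, weight (-(9 / 8)) x) * weight (-(5 / 8)) (p - q) := by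
  have h : ∀ τ, weight (-(7 / 8)) (τ - p) * weight (-(7 / 8)) (τ - q) ≤
      2 * weight (-(5 / 8)) (p - q) * (weight (-(9 / 8)) (τ - p) + weight (-(9 / 8)) (τ - q)) := by
    intro τ
    have h1 := bracket_sub_le (τ - q) (τ - p)
    rw [show τ - q - (τ - p) = p - q by ring] at h1
    have h0 : ∀ r x : ℝ, 0 ≤ bracket x ^ r := fun r x => Real.rpow_nonneg (bracket_pos x).le r
    unfold weight
    rw [← ENNReal.ofReal_mul (h0 _ _), ← ENNReal.ofReal_add (h0 _ _) (h0 _ _),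
      ← ENNReal.ofReal_ofNat 2, ← ENNReal.ofReal_mul (by norm_num), ← ENNReal.ofReal_mul]
    · exact ENNReal.ofReal_le_ofReal (rpow_mul_rpow_le_of_le_add (one_le_bracket _)
        (one_le_bracket _) (one_le_bracket _) (by linarith))
    · have := h0 (-(5 / 8)) (p - q)
      positivity
  refine (lintegral_mono h).trans (le_of_eq ?_)
  have hm := measurable_weight (-(9 / 8))
  rw [lintegral_const_mul _ (by fun_prop), lintegral_add_left (by fun_prop),
    lintegral_weight_sub, lintegral_weight_sub]
  ring

lemma summable_one_add_abs_int_rpow {r : ℝ} (hr : 1 < r) :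
    Summable fun m : ℤ => (1 + |(m : ℝ)|) ^ (-r) := by
  refine Summable.of_norm_bounded_eventually
    (g := fun m : ℤ => |(m : ℝ)| ^ (-r)) (Real.summable_abs_int_rpow hr) ?_
  filter_upwards [(Set.finite_singleton (0 : ℤ)).compl_mem_cofinite] with m hm
  have : 0 < |(m : ℝ)| := abs_pos.2 (Int.cast_ne_zero.2 hm)
  rw [Real.norm_of_nonneg (by positivity)]
  exact Real.rpow_le_rpow_of_nonpos this (by linarith) (by linarith)

/-- A sum of weights along a sequence of separated points. -/
theorem sum_weight_le_of_separated {c : ℝ} (hc : 0 < c) :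
    -- The exponent 1/2 is not optimal; its square root `N^(1/4)` is what the trilinear estimate can
    -- afford.
    ∃ A : ℝ, 0 < A ∧ ∀ (N : ℕ) (B : Finset ℤ) (a : ℤ → ℝ), 1 ≤ N →
      (∀ k ∈ B, |(k : ℝ)| ≤ 2 * N) →
      (∀ k ∈ B, ∀ j ∈ B, c * |(k : ℝ) - j| ≤ |a k - a j|) →
      ∑ k ∈ B, weight (-(5 / 8)) (a k) ≤ ENNReal.ofReal (A * (N : ℝ) ^ (1 / 2 : ℝ)) := by
  set c' := min (1 / 2) (c / 4) with hc'
  have hc'0 : 0 < c' := by positivity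
  set Z := ∑' m : ℤ, (1 + |(m : ℝ)|) ^ (-(9 / 8) : ℝ) with hZ
  have hsum := summable_one_add_abs_int_rpow (r := 9 / 8) (by norm_num)
  have hZ0 : 0 ≤ Z := tsum_nonneg fun m => by positivity
  refine ⟨c' ^ (-(5 / 8) : ℝ) * 5 ^ (1 / 2 : ℝ) * (Z + 1), by positivity, ?_⟩
  intro N B a hN hB ha
  have hN' : (1 : ℝ) ≤ N := by exact_mod_cast hN
  rcases B.eq_empty_or_nonempty with rfl | hne
  · simp
  -- Measured from a minimizer `l` of `|a|`, separation gives `|a k| ≥ c|k - l|/2`. Averaging this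
  -- with `⟨a k⟩ ≥ 1` yields `⟨a k⟩ ≥ c'(1 + |k - l|)`.
  obtain ⟨l, hl, hmin⟩ := B.exists_min_image (fun k => |a k|) hne
  have hterm : ∀ k ∈ B, bracket (a k) ^ (-(5 / 8) : ℝ) ≤
      c' ^ (-(5 / 8) : ℝ) * 5 ^ (1 / 2 : ℝ) * (N : ℝ) ^ (1 / 2 : ℝ) *
        (1 + |((k - l : ℤ) : ℝ)|) ^ (-(9 / 8) : ℝ) := by
    intro k hk
    set m : ℝ := |((k - l : ℤ) : ℝ)| with hm
    have hm0 : 0 ≤ m := abs_nonneg _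
    have h1 : c * m ≤ 2 * |a k| := by
      have e1 := ha k hk l hl
      have e2 := hmin k hk
      have e3 := abs_sub (a k) (a l)
      have e4 : |(k : ℝ) - l| = m := by rw [hm]; push_cast; rfl
      rw [e4] at e1
      linarith
    have h2 : c' * (1 + m) ≤ bracket (a k) := by
      have e1 := one_le_bracket (a k)
      have e2 := abs_le_bracket (a k)
      have e3 : c' ≤ 1 / 2 := min_le_left _ _
      have e4 : c' * m ≤ c / 4 * m := by gcongr; exact min_le_right _ _
      nlinarith
    have h3 : m ≤ 4 * N := by
      have e1 := hB k hk
      have e2 := hB l hl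
      have e3 := abs_sub (k : ℝ) l
      rw [hm]; push_cast
      linarith
    calc bracket (a k) ^ (-(5 / 8) : ℝ) ≤ (c' * (1 + m)) ^ (-(5 / 8) : ℝ) :=
          Real.rpow_le_rpow_of_nonpos (by positivity) h2 (by norm_num)
      _ = c' ^ (-(5 / 8) : ℝ) * ((1 + m) ^ (1 / 2 : ℝ) * (1 + m) ^ (-(9 / 8) : ℝ)) := by
          rw [Real.mul_rpow hc'0.le (by positivity), ← Real.rpow_add (by positivity)]
          norm_num
      -- The factor `(1 + m)^(1/2)` is given up to `(5N)^(1/2)`, which leaves the summable power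
      -- -9/8.
      _ ≤ c' ^ (-(5 / 8) : ℝ) * ((5 * N) ^ (1 / 2 : ℝ) * (1 + m) ^ (-(9 / 8) : ℝ)) := by
          gcongr
          linarith
      _ = _ := by
          rw [Real.mul_rpow (by norm_num) (by positivity)]; ring
  have hpos : ∀ k ∈ B, 0 ≤ bracket (a k) ^ (-(5 / 8) : ℝ) := fun k _ =>
    Real.rpow_nonneg (bracket_pos _).le _
  unfold weight
  rw [← ENNReal.ofReal_sum_of_nonneg hpos]
  refine ENNReal.ofReal_le_ofReal ((Finset.sum_le_sum hterm).trans ?_)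
  rw [← Finset.mul_sum]
  have hS : ∑ k ∈ B, (1 + |((k - l : ℤ) : ℝ)|) ^ (-(9 / 8) : ℝ) ≤ Z := by
    rw [hZ, ← (Equiv.subRight l).tsum_eq (fun m : ℤ => (1 + |(m : ℝ)|) ^ (-(9 / 8) : ℝ))]
    exact Summable.sum_le_tsum (f := fun k : ℤ => (1 + |((k - l : ℤ) : ℝ)|) ^ (-(9 / 8) : ℝ)) B
      (fun k _ => by positivity) ((Equiv.subRight l).summable_iff.2 hsum)
  calc _ ≤ c' ^ (-(5 / 8) : ℝ) * 5 ^ (1 / 2 : ℝ) * (N : ℝ) ^ (1 / 2 : ℝ) * (Z + 1) := by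
        gcongr; linarith
    _ = _ := by ring

end Bracket

/-! ### Modulations and the resonance identity. -/

/-- The Schrödinger modulation `τ - αk²`. -/
def modS (α : ℝ) (x : ℤ × ℝ) : ℝ := x.2 - α * (x.1 : ℝ) ^ 2

/-- The wave modulation `|τ| - β|k|`. -/
def modW (β : ℝ) (x : ℤ × ℝ) : ℝ := |x.2| - β * |(x.1 : ℝ)|

lemma measurable_modS (α : ℝ) : Measurable (modS α) := by
  unfold modS
  have : Measurable fun x : ℤ × ℝ => (x.1 : ℝ) := measurable_from_top.comp measurable_fst
  fun_prop

lemma measurable_modW (β : ℝ) : Measurable (modW β) := by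
  unfold modW
  have : Measurable fun x : ℤ × ℝ => (x.1 : ℝ) := measurable_from_top.comp measurable_fst
  fun_prop

/-- This replaces the cone `|τ| = β|k|` by a line of slope `±β`, to which the algebraic resonance
identity applies. -/
lemma exists_sign_abs_modW (β : ℝ) (z : ℤ × ℝ) :
    ∃ s : ℝ, (s = 1 ∨ s = -1) ∧ |modW β z| = |z.2 - s * β * z.1| := by
  unfold modW
  rcases abs_choice z.2 with h | h <;> rcases abs_choice (z.1 : ℝ) with h' | h' <;> rw [h, h']
  · exact ⟨1, by simp, by congr 1; ring⟩
  · exact ⟨-1, by simp, by congr 1; ring⟩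
  · exact ⟨-1, by simp, by rw [← abs_neg]; congr 1; ring⟩
  · exact ⟨1, by simp, by rw [← abs_neg]; congr 1; ring⟩

lemma weight_modW_le (r β : ℝ) (z : ℤ × ℝ) :
    weight r (modW β z) ≤ weight r (z.2 - 1 * β * z.1) + weight r (z.2 - (-1) * β * z.1) := by
  obtain ⟨s, hs, h⟩ := exists_sign_abs_modW β z
  rw [← weight_abs, h, weight_abs]
  rcases hs with rfl | rfl
  · exact le_self_add
  · exact le_add_self

/-- The distance `c₀` from `β/α` to the nearest integer is positive, and `αc₀` is a uniform lower
bound. For large `|m|` the bound `α|m| - β` takes over, and a weighted combination of the two yields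
linear growth. -/
lemma exists_lower_bound_of_not_integer {α β : ℝ} (hα : 0 < α) (hβ : 0 < β)
    (hβα : ∀ m : ℤ, β / α ≠ (m : ℝ)) :
    ∃ c : ℝ, 0 < c ∧ ∀ (m : ℤ) (s : ℝ), s = 1 ∨ s = -1 →
      c ≤ |α * m - s * β| ∧ c * |(m : ℝ)| ≤ |α * m - s * β| := by
  set c₀ := |β / α - round (β / α)| with hc₀
  have hc₀pos : 0 < c₀ := abs_pos.2 (sub_ne_zero.2 (hβα _))
  have hd : 0 < α * c₀ := by positivity
  have key : ∀ (m : ℤ) (s : ℝ), s = 1 ∨ s = -1 → α * c₀ ≤ |α * m - s * β| := by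
    intro m s hs
    have h1 : ∀ n : ℤ, α * c₀ ≤ |α * n - β| := fun n => by
      have : α * n - β = -(α * (β / α - n)) := by field_simp; ring
      rw [this, abs_neg, abs_mul, abs_of_pos hα]
      gcongr
      exact round_le _ _
    rcases hs with rfl | rfl
    · simpa using h1 m
    · have h2 := h1 (-m)
      rw [← abs_neg] at h2
      convert h2 using 2
      push_cast; ring
  refine ⟨min (α * c₀) (α * (α * c₀) / (α * c₀ + β)), by positivity, fun m s hs => ?_⟩
  have h1 := key m s hs
  refine ⟨(min_le_left _ _).trans h1, ?_⟩
  have h2 : α * |(m : ℝ)| - β ≤ |α * m - s * β| := by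
    have e1 := abs_sub_abs_le_abs_sub (α * (m : ℝ)) (s * β)
    have e2 : |s * β| = β := by
      rcases hs with rfl | rfl <;> simp [abs_of_pos hβ]
    rw [abs_mul, abs_of_pos hα, e2] at e1
    exact e1
  calc _ ≤ α * (α * c₀) / (α * c₀ + β) * |(m : ℝ)| := by gcongr; exact min_le_right _ _
    _ = (α * c₀) * (α * |(m : ℝ)|) / (α * c₀ + β) := by ring
    _ ≤ |α * m - s * β| := by
        rw [div_le_iff₀ (by positivity)]
        nlinarith

/-- Nonresonance bounds all three frequencies by the sum of the two Schrödinger frequencies. -/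
lemma le_abs_add_of_nonresonant {C : ℝ} (hC : 2 < C) {k l : ℤ}
    (h : (k - l, k, l) ∈ nonresonantSet C) :
    |(k : ℝ)| ≤ C / (C - 2) * |((k + l : ℤ) : ℝ)| ∧ |(l : ℝ)| ≤ C / (C - 2) * |((k + l : ℤ) : ℝ)| ∧
      |((k - l : ℤ) : ℝ)| ≤ C / (C - 2) * |((k + l : ℤ) : ℝ)| := by
  have hC2 : 0 < C - 2 := by linarith
  push_cast
  set m : ℝ := (k : ℝ) + l with hm
  set n : ℝ := (k : ℝ) - l with hn
  have hk : (k : ℝ) = (m + n) / 2 := by rw [hm, hn]; ring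
  have hl : (l : ℝ) = (m - n) / 2 := by rw [hm, hn]; ring
  -- If `k + l` were too small compared with `n = k - l`, then `k ≈ n/2` and `l ≈ -n/2`. All three
  -- frequencies would be comparable up to a factor close to 2, hence resonant because `C > 2`.
  have hcase : |n| * (C - 2) ≤ C * |m| := by
    by_contra! hlt
    refine h ?_
    have b1 : 2 * |(k : ℝ)| ≤ |m| + |n| := by
      rw [hk, abs_div, abs_two]; linarith [abs_add_le m n]
    have b2 : 2 * |(l : ℝ)| ≤ |m| + |n| := by
      rw [hl, abs_div, abs_two]; linarith [abs_sub m n]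
    have b3 : |n| - |m| ≤ 2 * |(k : ℝ)| := by
      rw [hk, abs_div, abs_two]
      have := abs_sub_abs_le_abs_sub n (-m)
      rw [abs_neg, sub_neg_eq_add, add_comm n m] at this
      linarith
    have b4 : |n| - |m| ≤ 2 * |(l : ℝ)| := by
      rw [hl, abs_div, abs_two]
      have := abs_sub_abs_le_abs_sub n m
      rw [abs_sub_comm n m] at this
      linarith
    have hm0 := abs_nonneg m
    have hn0 := abs_nonneg n
    have b5 : C * (|n| - |m|) ≥ 2 * |n| := by nlinarith
    have b6 : C * (|n| - |m|) ≥ |n| + |m| := by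
      have : |m| ≤ |n| := by nlinarith
      linarith
    have b7 : |m| ≤ |n| := by nlinarith
    simp only [resonantSet, Comparable, Set.mem_ofPred_eq]
    push_cast
    rw [← hn]
    refine ⟨⟨?_, ?_⟩, ⟨?_, ?_⟩, ?_, ?_⟩ <;> nlinarith
  have h3 : |n| ≤ C / (C - 2) * |m| := by
    rw [div_mul_eq_mul_div, le_div_iff₀ hC2]
    exact hcase
  have h4 : |m| ≤ C / (C - 2) * |m| := by
    have : 1 ≤ C / (C - 2) := by rw [le_div_iff₀ hC2]; linarith
    nlinarith [abs_nonneg m]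
  refine ⟨?_, ?_, h3⟩
  · rw [hk, abs_div, abs_two]; linarith [abs_add_le m n]
  · rw [hl, abs_div, abs_two]; linarith [abs_sub m n]

lemma mem_block {N : ℕ} {k : ℤ} : k ∈ block N ↔ (N : ℤ) ≤ |k| ∧ |k| < 2 * N := by
  simp only [block, Finset.mem_filter, Finset.mem_Ioo, ← abs_lt]
  tauto

lemma le_abs_of_mem_block {N : ℕ} {k : ℤ} (h : k ∈ block N) : (N : ℝ) ≤ |(k : ℝ)| := by
  have := (mem_block.1 h).1
  exact_mod_cast this

lemma abs_le_of_mem_block {N : ℕ} {k : ℤ} (h : k ∈ block N) : |(k : ℝ)| ≤ 2 * N := by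
  have := (mem_block.1 h).2.le
  exact_mod_cast this

/-- The resonance identity: one of the modulations of a nonresonant interaction is large. -/
theorem exists_modulation_lower_bound {α β : ℝ} (hα : 0 < α) (hβ : 0 < β)
    (hβα : ∀ m : ℤ, β / α ≠ (m : ℝ)) {C : ℝ} (hC : 2 < C) :
    ∃ c : ℝ, 0 < c ∧ ∀ (Nx Ny Nz : ℕ) (x y : ℤ × ℝ), x.1 ∈ block Nx → y.1 ∈ block Ny →
      (x - y).1 ∈ block Nz → (x.1 - y.1, x.1, y.1) ∈ nonresonantSet C →
      c * (Nz * (max Nx (max Ny Nz) : ℕ)) ≤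
        bracket (modS α x) + bracket (modS α y) + bracket (modW β (x - y)) := by
  obtain ⟨c, hc, hlow⟩ := exists_lower_bound_of_not_integer hα hβ hβα
  have hC2 : 0 < C - 2 := by linarith
  refine ⟨c * ((C - 2) / C), by positivity, fun Nx Ny Nz x y hx hy hz hnr => ?_⟩
  obtain ⟨s, hs, hW⟩ := exists_sign_abs_modW β (x - y)
  obtain ⟨r1, r2, r3⟩ := le_abs_add_of_nonresonant hC hnr
  set m : ℤ := x.1 + y.1 with hm
  have hM : ((max Nx (max Ny Nz) : ℕ) : ℝ) ≤ C / (C - 2) * |(m : ℝ)| := by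
    push_cast
    exact max_le ((le_abs_of_mem_block hx).trans r1)
      (max_le ((le_abs_of_mem_block hy).trans r2) ((le_abs_of_mem_block hz).trans r3))
  have hM' : (C - 2) / C * ((max Nx (max Ny Nz) : ℕ) : ℝ) ≤ |(m : ℝ)| := by
    rw [div_mul_eq_mul_div, le_div_iff₀ hC2] at hM
    rw [div_mul_eq_mul_div, div_le_iff₀ (by linarith)]
    linarith
  -- The time frequencies cancel, leaving `α(k² - l²) - sβ(k - l)`, which factors.
  have hid : ((x - y).1 : ℝ) * (α * m - s * β) =
      -modS α x + modS α y + ((x - y).2 - s * β * (x - y).1) := by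
    simp only [modS, hm, Prod.fst_sub, Prod.snd_sub]
    push_cast; ring
  have hz' := le_abs_of_mem_block hz
  calc c * ((C - 2) / C) * (Nz * (max Nx (max Ny Nz) : ℕ))
      = Nz * (c * ((C - 2) / C * (max Nx (max Ny Nz) : ℕ))) := by ring
    _ ≤ |((x - y).1 : ℝ)| * (c * |(m : ℝ)|) := by gcongr
    _ ≤ |((x - y).1 : ℝ)| * |α * m - s * β| := by gcongr; exact (hlow m s hs).2
    _ = |(-modS α x + modS α y + ((x - y).2 - s * β * (x - y).1))| := by rw [← abs_mul, hid]
    _ ≤ |modS α x| + |modS α y| + |modW β (x - y)| := by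
        rw [hW]
        refine (abs_add_three _ _ _).trans ?_
        rw [abs_neg]
    _ ≤ _ := by gcongr <;> exact abs_le_bracket _

/-! ### `L²` bounds for the kernels of the two remaining modulations. -/

/-- The product of two weights centred on two curves, over the frequencies in `B`. -/
noncomputable def curveKernel (B : Finset ℤ) (p q : ℤ → ℝ) (x : ℤ × ℝ) : ℝ≥0∞ :=
  if x.1 ∈ B then weight (-(7 / 8)) (x.2 - p x.1) * weight (-(7 / 8)) (x.2 - q x.1) else 0

lemma measurable_curveKernel (B : Finset ℤ) (p q : ℤ → ℝ) : Measurable (curveKernel B p q) := by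
  have hm := measurable_weight (-(7 / 8))
  refine measurable_from_prod_countable_right fun k => ?_
  by_cases hk : k ∈ B <;> simp only [curveKernel, hk, if_true, if_false] <;> fun_prop

/-- The time integral leaves the weight of exponent -5/8 at the gap `p k - q k`, and the separated
gaps are then summed over `B`. -/
theorem lintegral_curveKernel_le {c : ℝ} (hc : 0 < c) :
    ∃ A : ℝ, 0 < A ∧ ∀ (N : ℕ) (B : Finset ℤ) (p q : ℤ → ℝ), 1 ≤ N →
      (∀ k ∈ B, |(k : ℝ)| ≤ 2 * N) →
      (∀ k ∈ B, ∀ j ∈ B, c * |(k : ℝ) - j| ≤ |(p k - q k) - (p j - q j)|) →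
      ∫⁻ x, curveKernel B p q x ∂freqMeasure ≤ ENNReal.ofReal (A * (N : ℝ) ^ (1 / 2 : ℝ)) := by
  obtain ⟨A, hA, h⟩ := sum_weight_le_of_separated hc
  set I := ∫⁻ x, weight (-(9 / 8)) x with hI
  have hItop : I ≠ ∞ := (lintegral_weight_lt_top (by norm_num)).ne
  refine ⟨4 * (I.toReal + 1) * A, by positivity, fun N B p q hN hB hsep => ?_⟩
  rw [lintegral_freqMeasure (measurable_curveKernel B p q), tsum_eq_sum (s := B)]
  swap
  · intro k hk
    simp [curveKernel, hk]
  calc ∑ k ∈ B, ∫⁻ τ, curveKernel B p q (k, τ)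
      ≤ ∑ k ∈ B, 4 * I * weight (-(5 / 8)) (p k - q k) := by
        refine Finset.sum_le_sum fun k hk => ?_
        simp only [curveKernel, hk, if_true]
        exact lintegral_weight_mul_weight_le _ _
    _ ≤ 4 * I * ENNReal.ofReal (A * (N : ℝ) ^ (1 / 2 : ℝ)) := by
        rw [← Finset.mul_sum]
        gcongr
        exact h N B _ hN hB hsep
    _ ≤ ENNReal.ofReal (4 * (I.toReal + 1)) * ENNReal.ofReal (A * (N : ℝ) ^ (1 / 2 : ℝ)) := by
        gcongr
        rw [ENNReal.ofReal_mul (by norm_num), ENNReal.ofReal_ofNat]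
        gcongr
        rw [ENNReal.le_ofReal_iff_toReal_le hItop (by positivity)]
        linarith
    _ = _ := by rw [← ENNReal.ofReal_mul (by positivity)]; congr 1; ring

/-- With `x` fixed, the time frequency of `y` is weighted around the parabola `αk²` and around two
lines of slope `±β`; each line contributes one `curveKernel`. -/
lemma weight_modS_mul_modW_le (α β : ℝ) (B : Finset ℤ) (x y : ℤ × ℝ) (hy : y.1 ∈ B) :
    weight (-(7 / 8)) (modS α y) * weight (-(7 / 8)) (modW β (x - y)) ≤
      curveKernel B (fun k => α * (k : ℝ) ^ 2) (fun k => x.2 - 1 * β * (x.1 - k)) y +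
      curveKernel B (fun k => α * (k : ℝ) ^ 2) (fun k => x.2 - (-1) * β * (x.1 - k)) y := by
  simp only [curveKernel, hy, if_true]
  rw [← mul_add]
  refine mul_le_mul' le_rfl ((weight_modW_le _ _ _).trans (le_of_eq ?_))
  congr 1 <;> rw [← weight_neg] <;> congr 1 <;> simp only [Prod.fst_sub, Prod.snd_sub] <;>
    push_cast <;> ring

lemma weight_modS_mul_modW_le' (α β : ℝ) (B : Finset ℤ) (x y : ℤ × ℝ) (hx : x.1 ∈ B) :
    weight (-(7 / 8)) (modS α x) * weight (-(7 / 8)) (modW β (x - y)) ≤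
      curveKernel B (fun k => α * (k : ℝ) ^ 2) (fun k => y.2 + 1 * β * (k - y.1)) x +
      curveKernel B (fun k => α * (k : ℝ) ^ 2) (fun k => y.2 + (-1) * β * (k - y.1)) x := by
  simp only [curveKernel, hx, if_true]
  rw [← mul_add]
  refine mul_le_mul' le_rfl ((weight_modW_le _ _ _).trans (le_of_eq ?_))
  congr 1 <;> congr 1 <;> simp only [Prod.fst_sub, Prod.snd_sub] <;>
    push_cast <;> ring

lemma measurable_weight_comp_sub (r : ℝ) {m : ℤ × ℝ → ℝ} (hm : Measurable m) :
    Measurable fun p : (ℤ × ℝ) × (ℤ × ℝ) => weight r (m (p.1 - p.2)) :=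
  (measurable_weight r).comp (hm.comp (measurable_fst.sub measurable_snd))

/-- The kernel left over when the modulation of `x` is the largest. -/
noncomputable def kernelLeft (α β : ℝ) (B : Finset ℤ) (x y : ℤ × ℝ) : ℝ≥0∞ :=
  if y.1 ∈ B then weight (-(7 / 16)) (modS α y) * weight (-(7 / 16)) (modW β (x - y)) else 0

/-- The kernel left over when the modulation of `y` is the largest. -/
noncomputable def kernelRight (α β : ℝ) (B : Finset ℤ) (x y : ℤ × ℝ) : ℝ≥0∞ :=
  if x.1 ∈ B then weight (-(7 / 16)) (modS α x) * weight (-(7 / 16)) (modW β (x - y)) else 0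

/-- The kernel left over when the modulation of `x - y` is the largest. -/
noncomputable def kernelDiag (α : ℝ) (B : Finset ℤ) (x y : ℤ × ℝ) : ℝ≥0∞ :=
  if y.1 ∈ B ∧ (x - y).1 ≠ 0 then
    weight (-(7 / 16)) (modS α x) * weight (-(7 / 16)) (modS α y) else 0

lemma measurable_kernelLeft (α β : ℝ) (B : Finset ℤ) :
    Measurable (Function.uncurry (kernelLeft α β B)) := by
  have hs : MeasurableSet {p : (ℤ × ℝ) × (ℤ × ℝ) | p.2.1 ∈ B} :=
    (measurable_fst.comp measurable_snd) (MeasurableSet.of_discrete (s := (B : Set ℤ)))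
  exact Measurable.ite hs (((measurable_weight _).comp
    ((measurable_modS α).comp measurable_snd)).mul
    (measurable_weight_comp_sub _ (measurable_modW β))) measurable_const

lemma measurable_kernelRight (α β : ℝ) (B : Finset ℤ) :
    Measurable (Function.uncurry (kernelRight α β B)) := by
  have hs : MeasurableSet {p : (ℤ × ℝ) × (ℤ × ℝ) | p.1.1 ∈ B} :=
    (measurable_fst.comp measurable_fst) (MeasurableSet.of_discrete (s := (B : Set ℤ)))
  exact Measurable.ite hs (((measurable_weight _).comp
    ((measurable_modS α).comp measurable_fst)).mul
    (measurable_weight_comp_sub _ (measurable_modW β))) measurable_const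

lemma measurable_kernelDiag (α : ℝ) (B : Finset ℤ) :
    Measurable (Function.uncurry (kernelDiag α B)) := by
  have hs : MeasurableSet {p : (ℤ × ℝ) × (ℤ × ℝ) | p.2.1 ∈ B ∧ (p.1 - p.2).1 ≠ 0} := by
    refine MeasurableSet.inter ((measurable_fst.comp measurable_snd)
      (MeasurableSet.of_discrete (s := (B : Set ℤ)))) ?_
    exact (measurable_fst.comp (measurable_fst.sub measurable_snd))
      (MeasurableSet.of_discrete (s := {k : ℤ | k ≠ 0}))
  exact Measurable.ite hs (((measurable_weight _).comp
    ((measurable_modS α).comp measurable_fst)).mul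
    ((measurable_weight _).comp ((measurable_modS α).comp measurable_snd))) measurable_const

lemma weight_mul_weight_sq (a b : ℝ) :
    (weight (-(7 / 16)) a * weight (-(7 / 16)) b) ^ 2 =
      weight (-(7 / 8)) a * weight (-(7 / 8)) b := by
  rw [mul_pow, weight_sq, weight_sq]
  norm_num

/-- The square of each kernel is dominated by `curveKernel`s. Between a parabola and a line the gaps
differ by `(k - j)(α(k + j) ∓ β)`, whose second factor stays away from 0 as `β/α` is not an integer.
Between two parabolas shifted by `z.1` they differ by `2α z.1 (k - j)`. -/
theorem exists_kernel_bound {α β : ℝ} (hα : 0 < α) (hβ : 0 < β)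
    (hβα : ∀ m : ℤ, β / α ≠ (m : ℝ)) :
    ∃ S : ℝ, 0 < S ∧ ∀ (N : ℕ) (B : Finset ℤ), 1 ≤ N → (∀ k ∈ B, |(k : ℝ)| ≤ 2 * N) →
      (∀ x, ∫⁻ y, kernelLeft α β B x y ^ 2 ∂freqMeasure ≤
        ENNReal.ofReal (S * (N : ℝ) ^ (1 / 4 : ℝ)) ^ 2) ∧
      (∀ y, ∫⁻ x, kernelRight α β B x y ^ 2 ∂freqMeasure ≤
        ENNReal.ofReal (S * (N : ℝ) ^ (1 / 4 : ℝ)) ^ 2) ∧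
      (∀ z, ∫⁻ y, kernelDiag α B (y + z) y ^ 2 ∂freqMeasure ≤
        ENNReal.ofReal (S * (N : ℝ) ^ (1 / 4 : ℝ)) ^ 2) := by
  obtain ⟨c, hc, hlow⟩ := exists_lower_bound_of_not_integer hα hβ hβα
  obtain ⟨A, hA, hcurve⟩ := lintegral_curveKernel_le (c := min c (2 * α)) (by positivity)
  -- The 2 accounts for the two signs in the wave weight.
  refine ⟨Real.sqrt (2 * A), by positivity, fun N B hN hB => ?_⟩
  have hS : ENNReal.ofReal (Real.sqrt (2 * A) * (N : ℝ) ^ (1 / 4 : ℝ)) ^ 2 =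
      ENNReal.ofReal (A * (N : ℝ) ^ (1 / 2 : ℝ)) + ENNReal.ofReal (A * (N : ℝ) ^ (1 / 2 : ℝ)) := by
    rw [← ENNReal.ofReal_pow (by positivity), ← ENNReal.ofReal_add (by positivity) (by positivity)]
    congr 1
    rw [mul_pow, Real.sq_sqrt (by positivity), ← Real.rpow_natCast, ← Real.rpow_mul (by positivity)]
    norm_num
    ring
  have hsep : ∀ (k j : ℤ) (s : ℝ), s = 1 ∨ s = -1 → min c (2 * α) * |(k : ℝ) - j| ≤
      |((k : ℝ) - j) * (α * (k + j) - s * β)| := by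
    intro k j s hs
    rw [abs_mul, mul_comm]
    gcongr
    have := (hlow (k + j) s hs).1
    push_cast at this
    exact (min_le_left _ _).trans this
  rw [hS]
  refine ⟨fun x => ?_, fun y => ?_, fun z => ?_⟩
  · have hle : ∀ y, kernelLeft α β B x y ^ 2 ≤
      curveKernel B (fun k => α * (k : ℝ) ^ 2) (fun k => x.2 - 1 * β * (x.1 - k)) y +
      curveKernel B (fun k => α * (k : ℝ) ^ 2) (fun k => x.2 - (-1) * β * (x.1 - k)) y := by
      intro y
      by_cases hy : y.1 ∈ B
      · simp only [kernelLeft, hy, if_true]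
        rw [weight_mul_weight_sq]
        exact weight_modS_mul_modW_le α β B x y hy
      · simp [kernelLeft, hy]
    refine (lintegral_mono hle).trans ?_
    rw [lintegral_add_left (measurable_curveKernel _ _ _)]
    gcongr <;> refine hcurve N B _ _ hN hB fun k _ j _ => ?_
    · convert hsep k j 1 (by simp) using 2; ring
    · convert hsep k j (-1) (by simp) using 2; ring
  · have hle : ∀ x, kernelRight α β B x y ^ 2 ≤
      curveKernel B (fun k => α * (k : ℝ) ^ 2) (fun k => y.2 + 1 * β * (k - y.1)) x +
      curveKernel B (fun k => α * (k : ℝ) ^ 2) (fun k => y.2 + (-1) * β * (k - y.1)) x := by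
      intro x
      by_cases hx : x.1 ∈ B
      · simp only [kernelRight, hx, if_true]
        rw [weight_mul_weight_sq]
        exact weight_modS_mul_modW_le' α β B x y hx
      · simp [kernelRight, hx]
    refine (lintegral_mono hle).trans ?_
    rw [lintegral_add_left (measurable_curveKernel _ _ _)]
    gcongr <;> refine hcurve N B _ _ hN hB fun k _ j _ => ?_
    · convert hsep k j 1 (by simp) using 2; ring
    · convert hsep k j (-1) (by simp) using 2; ring
  -- For `z.1 = 0` the two parabolas are parallel and their gaps are not separated; `kernelDiag` is
  -- set to zero there.
  · by_cases hz : z.1 = 0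
    · simp [kernelDiag, hz]
    have hle : ∀ y, kernelDiag α B (y + z) y ^ 2 ≤
      curveKernel B (fun k => α * (k + z.1 : ℝ) ^ 2 - z.2) (fun k => α * (k : ℝ) ^ 2) y := by
      intro y
      by_cases hy : y.1 ∈ B
      · simp only [kernelDiag, curveKernel, hy, if_true, add_sub_cancel_left, ne_eq, hz,
          not_false_eq_true, and_self]
        rw [weight_mul_weight_sq]
        refine le_of_eq ?_
        congr 2
        simp only [modS, Prod.fst_add, Prod.snd_add]
        push_cast; ring
      · simp [kernelDiag, hy]
    refine ((lintegral_mono hle).trans (hcurve N B _ _ hN hB fun k _ j _ => ?_)).trans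
      le_self_add
    have h1 : (1 : ℝ) ≤ |(z.1 : ℝ)| := by exact_mod_cast Int.one_le_abs hz
    have h2 : α * (k + z.1 : ℝ) ^ 2 - z.2 - α * (k : ℝ) ^ 2 -
        (α * (j + z.1 : ℝ) ^ 2 - z.2 - α * (j : ℝ) ^ 2) = 2 * α * z.1 * (k - j) := by ring
    rw [h2, abs_mul, abs_mul, abs_of_pos (by positivity : 0 < 2 * α)]
    gcongr
    calc min c (2 * α) ≤ 2 * α * 1 := by rw [mul_one]; exact min_le_right _ _
      _ ≤ _ := by gcongr

/-! ### The trilinear estimate. -/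

/-- The largest of `a`, `b`, `d` is at least `cL/3`. With the three modulations inserted, this is
the factor by which the integrand is multiplied. -/
lemma one_le_rpow_sum {c L a b d : ℝ} (hc : 0 < c) (hL : 0 < L) (ha : 1 ≤ a) (hb : 1 ≤ b)
    (hd : 1 ≤ d) (h : c * L ≤ a + b + d) :
    1 ≤ (c / 3) ^ (-(7 / 16) : ℝ) * L ^ (-(7 / 16) : ℝ) *
      (a ^ (7 / 16 : ℝ) + b ^ (7 / 16 : ℝ) + d ^ (7 / 16 : ℝ)) := by
  have h1 : (c / 3 * L) ^ (7 / 16 : ℝ) ≤ a ^ (7 / 16 : ℝ) + b ^ (7 / 16 : ℝ) + d ^ (7 / 16 : ℝ) := by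
    have ha' : 0 ≤ a ^ (7 / 16 : ℝ) := by positivity
    have hb' : 0 ≤ b ^ (7 / 16 : ℝ) := by positivity
    have hd' : 0 ≤ d ^ (7 / 16 : ℝ) := by positivity
    have hmono : ∀ t, c / 3 * L ≤ t → (c / 3 * L) ^ (7 / 16 : ℝ) ≤ t ^ (7 / 16 : ℝ) := fun t ht =>
      Real.rpow_le_rpow (by positivity) ht (by norm_num)
    by_cases h2 : c / 3 * L ≤ a
    · linarith [hmono a h2]
    by_cases h3 : c / 3 * L ≤ b
    · linarith [hmono b h3]
    linarith [hmono d (by linarith)]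
  rw [← Real.mul_rpow (by positivity) hL.le]
  calc (1 : ℝ) = (c / 3 * L) ^ (-(7 / 16) : ℝ) * (c / 3 * L) ^ (7 / 16 : ℝ) := by
        rw [← Real.rpow_add (by positivity)]; simp
    _ ≤ _ := by gcongr

/-- The nonresonant trilinear estimate for two Schrödinger waves and one acoustic wave. -/
theorem exists_trilinear_bound {α β : ℝ} (hα : 0 < α) (hβ : 0 < β)
    (hβα : ∀ m : ℤ, β / α ≠ (m : ℝ)) {C : ℝ} (hC : 2 < C) :
    ∃ A : ℝ, 0 < A ∧ ∀ Nx Ny Nz : ℕ, 1 ≤ Nx → 1 ≤ Ny → 1 ≤ Nz →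
      (∀ k ∈ block Nx, ∀ l ∈ block Ny, k - l ∈ block Nz → (k - l, k, l) ∈ nonresonantSet C) →
      ∀ f g h : ℤ × ℝ → ℝ≥0∞, Measurable f → Measurable g → Measurable h →
      (∀ x, x.1 ∉ block Nx → f x = 0) → (∀ x, x.1 ∉ block Ny → g x = 0) →
      (∀ x, x.1 ∉ block Nz → h x = 0) →
      ∫⁻ x, ∫⁻ y, f x * g y * h (x - y) ∂freqMeasure ∂freqMeasure ≤
        ENNReal.ofReal (A * ((max Nx (max Ny Nz) : ℕ) : ℝ) ^ (-(1 / 8) : ℝ) *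
          (Nz : ℝ) ^ (-(1 / 2) : ℝ)) *
        (l2norm freqMeasure (fun x => weight (7 / 16) (modS α x) * f x) *
          l2norm freqMeasure (fun x => weight (7 / 16) (modS α x) * g x) *
          l2norm freqMeasure (fun x => weight (7 / 16) (modW β x) * h x)) := by
  obtain ⟨c, hc, hmod⟩ := exists_modulation_lower_bound hα hβ hβα hC
  obtain ⟨S, hS, hker⟩ := exists_kernel_bound hα hβ hβα
  -- The first factor comes from the resonance bound, the 3 from the three choices of the largest
  -- modulation, and `S` from the kernels.
  refine ⟨(c / 3) ^ (-(7 / 16) : ℝ) * (3 * S), by positivity, ?_⟩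
  intro Nx Ny Nz hNx hNy hNz hnr f g h hf hg hh hfs hgs hhs
  set M : ℕ := max Nx (max Ny Nz) with hM
  have hxM : Nx ≤ M := le_max_left _ _
  have hyM : Ny ≤ M := (le_max_left _ _).trans (le_max_right _ _)
  have hzM : Nz ≤ M := (le_max_right _ _).trans (le_max_right _ _)
  have hM1 : 1 ≤ M := hNx.trans hxM
  have hM1' : (1 : ℝ) ≤ M := by exact_mod_cast hM1
  have hz1' : (1 : ℝ) ≤ Nz := by exact_mod_cast hNz
  have hzM' : (Nz : ℝ) ≤ M := by exact_mod_cast hzM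
  have hwS : Measurable fun x => weight (7 / 16) (modS α x) :=
    (measurable_weight _).comp (measurable_modS α)
  have hwW : Measurable fun x => weight (7 / 16) (modW β x) :=
    (measurable_weight _).comp (measurable_modW β)
  set f' : ℤ × ℝ → ℝ≥0∞ := fun x => weight (7 / 16) (modS α x) * f x with hf'
  set g' : ℤ × ℝ → ℝ≥0∞ := fun x => weight (7 / 16) (modS α x) * g x with hg'
  set h' : ℤ × ℝ → ℝ≥0∞ := fun x => weight (7 / 16) (modW β x) * h x with hh'
  have hf'm : Measurable f' := hwS.mul hf
  have hg'm : Measurable g' := hwS.mul hg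
  have hh'm : Measurable h' := hwW.mul hh
  have hbx : ∀ k ∈ block Nx, |(k : ℝ)| ≤ 2 * M := fun k hk =>
    (abs_le_of_mem_block hk).trans (by gcongr)
  have hby : ∀ k ∈ block Ny, |(k : ℝ)| ≤ 2 * M := fun k hk =>
    (abs_le_of_mem_block hk).trans (by gcongr)
  set R : ℝ≥0∞ := ENNReal.ofReal ((c / 3) ^ (-(7 / 16) : ℝ) * ((Nz : ℝ) * M) ^ (-(7 / 16) : ℝ))
    with hR
  set T : (ℤ × ℝ → ℤ × ℝ → ℝ≥0∞) → ℤ × ℝ → ℤ × ℝ → ℝ≥0∞ := fun K x y =>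
    f' x * g' y * h' (x - y) * K x y with hT
  have hTm : ∀ K, Measurable (Function.uncurry K) → Measurable (Function.uncurry (T K)) := by
    intro K hK
    have : Measurable (Function.uncurry fun x y => f' x * g' y * h' (x - y)) :=
      ((hf'm.comp measurable_fst).mul (hg'm.comp measurable_snd)).mul
        (hh'm.comp (measurable_fst.sub measurable_snd))
    exact this.mul hK
  have hpt : ∀ x y, f x * g y * h (x - y) ≤ R * (T (kernelLeft α β (block Ny)) x y +
      T (kernelRight α β (block Nx)) x y + T (kernelDiag α (block Ny)) x y) := by
    intro x y
    by_cases hx : x.1 ∈ block Nx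
    swap
    · simp [hfs x hx]
    by_cases hy : y.1 ∈ block Ny
    swap
    · simp [hgs y hy]
    by_cases hz : (x - y).1 ∈ block Nz
    swap
    · simp [hhs _ hz]
    have hz0 : (x - y).1 ≠ 0 := fun h0 => by
      have := le_abs_of_mem_block hz
      rw [h0] at this
      norm_num at this
      omega
    have hres : 1 ≤ R * (weight (7 / 16) (modS α x) + weight (7 / 16) (modS α y) +
        weight (7 / 16) (modW β (x - y))) := by
      have h1 := hmod Nx Ny Nz x y hx hy hz (hnr _ hx _ hy hz)
      have h2 := one_le_rpow_sum hc (by positivity : (0 : ℝ) < Nz * M) (one_le_bracket _)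
        (one_le_bracket _) (one_le_bracket _) h1
      have h0 : ∀ r x : ℝ, 0 ≤ bracket x ^ r := fun r x => Real.rpow_nonneg (bracket_pos x).le r
      unfold weight
      rw [hR, ← ENNReal.ofReal_add (h0 _ _) (h0 _ _),
        ← ENNReal.ofReal_add (add_nonneg (h0 _ _) (h0 _ _)) (h0 _ _),
        ← ENNReal.ofReal_mul (by positivity), ENNReal.one_le_ofReal]
      exact h2
    have ex := weight_neg_mul (7 / 16) (modS α x)
    have ey := weight_neg_mul (7 / 16) (modS α y)
    have ez := weight_neg_mul (7 / 16) (modW β (x - y))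
    simp only [hT, kernelLeft, kernelRight, kernelDiag, hx, hy, hz0, ne_eq, not_false_eq_true,
      and_self, if_true, hf', hg', hh']
    set wx := weight (7 / 16) (modS α x)
    set wy := weight (7 / 16) (modS α y)
    set wz := weight (7 / 16) (modW β (x - y))
    set vx := weight (-(7 / 16)) (modS α x)
    set vy := weight (-(7 / 16)) (modS α y)
    set vz := weight (-(7 / 16)) (modW β (x - y))
    -- In each of the three terms the weight of one modulation stays with its function. For the
    -- other two, `1 = ⟨σ⟩^(-7/16) ⟨σ⟩^(7/16)` is inserted: the positive power joins the function
    -- and the negative one forms the kernel.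
    calc f x * g y * h (x - y) ≤ f x * g y * h (x - y) * (R * (wx + wy + wz)) :=
          le_mul_of_one_le_right' hres
      _ = R * ((f x * g y * h (x - y)) * (wx * (vy * wy) * (vz * wz) +
            (vx * wx) * wy * (vz * wz) + (vx * wx) * (vy * wy) * wz)) := by
          rw [ex, ey, ez]; ring
      _ = _ := by ring
  have hNN : (0 : ℝ) < M := by positivity
  obtain ⟨k1, -, k3⟩ := hker M (block Ny) hM1 hby
  obtain ⟨-, k2, -⟩ := hker M (block Nx) hM1 hbx
  have b1 := lintegral_convolution_kernel_le_left freqMeasure hf'm hg'm hh'm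
    (measurable_kernelLeft α β (block Ny)) k1
  have b2 := lintegral_convolution_kernel_le_right freqMeasure hf'm hg'm hh'm
    (measurable_kernelRight α β (block Nx)) k2
  have b3 := lintegral_convolution_kernel_le_diag freqMeasure hf'm hg'm hh'm
    (measurable_kernelDiag α (block Ny)) k3
  have m1 := hTm _ (measurable_kernelLeft α β (block Ny))
  have m2 := hTm _ (measurable_kernelRight α β (block Nx))
  have m3 := hTm _ (measurable_kernelDiag α (block Ny))
  set Q := l2norm freqMeasure f' * l2norm freqMeasure g' * l2norm freqMeasure h' with hQ
  set σ := ENNReal.ofReal (S * (M : ℝ) ^ (1 / 4 : ℝ)) with hσ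
  calc ∫⁻ x, ∫⁻ y, f x * g y * h (x - y) ∂freqMeasure ∂freqMeasure
      ≤ ∫⁻ x, ∫⁻ y, R * (T (kernelLeft α β (block Ny)) x y +
      T (kernelRight α β (block Nx)) x y + T (kernelDiag α (block Ny)) x y)
        ∂freqMeasure ∂freqMeasure := lintegral_mono fun x => lintegral_mono fun y => hpt x y
    _ = R * (∫⁻ x, ∫⁻ y, T (kernelLeft α β (block Ny)) x y ∂freqMeasure ∂freqMeasure +
        ∫⁻ x, ∫⁻ y, T (kernelRight α β (block Nx)) x y ∂freqMeasure ∂freqMeasure +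
        ∫⁻ x, ∫⁻ y, T (kernelDiag α (block Ny)) x y ∂freqMeasure ∂freqMeasure) :=
        lintegral_lintegral_const_mul_add₃ _ _ m1 m2 m3 R
    _ ≤ R * (σ * Q + σ * Q + σ * Q) := by
        gcongr
    _ = R * (3 * σ) * Q := by ring
    _ ≤ _ := by
        gcongr
        rw [hR, hσ, ← ENNReal.ofReal_ofNat 3, ← ENNReal.ofReal_mul (by norm_num),
          ← ENNReal.ofReal_mul (by positivity)]
        refine ENNReal.ofReal_le_ofReal ?_
        -- Exponents of `M`: 1/16 from raising `Nz^(-7/16)` to the required `Nz^(-1/2)`, -7/16 from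
        -- resonance and 1/4 from the kernel, in total -1/8.
        have e1 : (Nz : ℝ) ^ (-(7 / 16) : ℝ) ≤
            (Nz : ℝ) ^ (-(1 / 2) : ℝ) * (M : ℝ) ^ (1 / 16 : ℝ) := by
          calc (Nz : ℝ) ^ (-(7 / 16) : ℝ) = (Nz : ℝ) ^ (-(1 / 2) : ℝ) * (Nz : ℝ) ^ (1 / 16 : ℝ) := by
                rw [← Real.rpow_add (by positivity)]; norm_num
            _ ≤ _ := by gcongr
        have e2 : (M : ℝ) ^ (-(1 / 8) : ℝ) =
            (M : ℝ) ^ (1 / 16 : ℝ) * (M : ℝ) ^ (-(7 / 16) : ℝ) * (M : ℝ) ^ (1 / 4 : ℝ) := by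
          rw [← Real.rpow_add hNN, ← Real.rpow_add hNN]; norm_num
        rw [Real.mul_rpow (by positivity) (by positivity), e2]
        calc (c / 3) ^ (-(7 / 16) : ℝ) * ((Nz : ℝ) ^ (-(7 / 16) : ℝ) * (M : ℝ) ^ (-(7 / 16) : ℝ)) *
              (3 * (S * (M : ℝ) ^ (1 / 4 : ℝ)))
            ≤ (c / 3) ^ (-(7 / 16) : ℝ) * (((Nz : ℝ) ^ (-(1 / 2) : ℝ) * (M : ℝ) ^ (1 / 16 : ℝ)) *
              (M : ℝ) ^ (-(7 / 16) : ℝ)) * (3 * (S * (M : ℝ) ^ (1 / 4 : ℝ))) := by gcongr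
          _ = _ := by ring

/-! ### The `Y` and `Z` norms in terms of weighted `L²` norms. -/

/-- The normalization constant of `ell2`. -/
noncomputable def ell2Const : ℝ≥0∞ := ENNReal.ofReal (1 / (2 * Real.pi)) ^ (1 / 2 : ℝ)

lemma ell2Const_ne_zero : ell2Const ≠ 0 := by
  have : 0 < 1 / (2 * Real.pi) := by positivity
  exact (ENNReal.rpow_pos (ENNReal.ofReal_pos.2 this) ENNReal.ofReal_ne_top).ne'

lemma ell2Const_ne_top : ell2Const ≠ ∞ :=
  ENNReal.rpow_ne_top_of_nonneg (by norm_num) ENNReal.ofReal_ne_top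

lemma ell2_mono {a b : ℤ → ℝ≥0∞} (h : ∀ k, a k ≤ b k) : ell2 a ≤ ell2 b := by
  unfold ell2
  gcongr with k
  exact h k

lemma ell2_const_mul (c : ℝ≥0∞) (a : ℤ → ℝ≥0∞) : ell2 (fun k => c * a k) = c * ell2 a := by
  unfold ell2
  simp_rw [ENNReal.mul_rpow_of_nonneg _ _ (zero_le_two (α := ℝ))]
  rw [ENNReal.tsum_mul_left, mul_left_comm,
    ENNReal.mul_rpow_of_nonneg (c ^ (2 : ℝ)) _ (by norm_num : (0 : ℝ) ≤ 1 / 2),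
    ← ENNReal.rpow_mul]
  norm_num

lemma ell2_l2norm {H : ℤ × ℝ → ℝ≥0∞} (hH : Measurable H) :
    ell2 (fun k => l2norm volume fun τ => H (k, τ)) = ell2Const * l2norm freqMeasure H := by
  unfold ell2 ell2Const
  rw [ENNReal.mul_rpow_of_nonneg _ _ (by norm_num : (0 : ℝ) ≤ 1 / 2), l2norm,
    lintegral_freqMeasure (hH.pow_const 2)]
  congr 3
  funext k
  rw [ENNReal.rpow_ofNat, l2norm_sq]

lemma eLpNorm_two_eq_l2norm (G : ℝ → ℂ) :
    eLpNorm G 2 volume = l2norm volume fun τ => ‖G τ‖ₑ := by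
  rw [eLpNorm_eq_lintegral_rpow_enorm_toReal (by norm_num) (by norm_num), l2norm]
  simp

lemma ell2Const_mul_l2norm_le {H : ℤ × ℝ → ℝ≥0∞} (hH : Measurable H) {G : ℤ → ℝ → ℂ}
    (h : ∀ k τ, H (k, τ) ≤ ‖G k τ‖ₑ) :
    ell2Const * l2norm freqMeasure H ≤ ell2 fun k => eLpNorm (G k) 2 volume := by
  rw [← ell2_l2norm hH]
  refine ell2_mono fun k => ?_
  rw [eLpNorm_two_eq_l2norm]
  exact l2norm_mono (h k)

lemma ell2_eLpNorm_two_le {H : ℤ × ℝ → ℝ≥0∞} (hH : Measurable H) {G : ℤ → ℝ → ℂ}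
    (h : ∀ k τ, ‖G k τ‖ₑ ≤ H (k, τ)) :
    ell2 (fun k => eLpNorm (G k) 2 volume) ≤ ell2Const * l2norm freqMeasure H := by
  rw [← ell2_l2norm hH]
  refine ell2_mono fun k => ?_
  rw [eLpNorm_two_eq_l2norm]
  exact l2norm_mono (h k)

lemma enorm_ofReal_mul (r : ℝ) (hr : 0 ≤ r) (z : ℂ) :
    ‖(r : ℂ) * z‖ₑ = ENNReal.ofReal r * ‖z‖ₑ := by
  rw [enorm_mul, ← ofReal_norm, Complex.norm_real, Real.norm_of_nonneg hr]

/-- Both parts of a `Z` norm are controlled by a weighted `L²` norm with an exponent below `1/2`. -/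
theorem ell2_add_ell2_le {m : ℤ × ℝ → ℝ} (hm : Measurable m) {I : ℝ≥0∞}
    (hI : ∀ k, ∫⁻ τ, weight (-(9 / 8)) (m (k, τ)) ≤ I) {r : ℤ → ℝ} (hr : ∀ k, 0 ≤ r k)
    {F : ℤ → ℝ → ℂ} {Φ : ℤ × ℝ → ℝ≥0∞} (hΦ : Measurable Φ)
    (h : ∀ k τ, ENNReal.ofReal (r k) * ‖F k τ‖ₑ ≤ Φ (k, τ)) :
    ell2 (fun k => eLpNorm
        (fun τ : ℝ => ((r k * bracket (m (k, τ)) ^ (-1 / 2 : ℝ) : ℝ) : ℂ) * F k τ) 2 volume) +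
      ell2 (fun k => eLpNorm
        (fun τ : ℝ => ((r k / bracket (m (k, τ)) : ℝ) : ℂ) * F k τ) 1 volume) ≤
      (1 + I ^ (1 / 2 : ℝ)) * (ell2Const *
        l2norm freqMeasure fun x => weight (-(7 / 16)) (m x) * Φ x) := by
  have hw : ∀ s, Measurable fun x => weight s (m x) := fun s => (measurable_weight s).comp hm
  have hH : Measurable fun x => weight (-(7 / 16)) (m x) * Φ x := (hw _).mul hΦ
  have h1 : ∀ (s : ℝ) k τ, ‖((r k * bracket (m (k, τ)) ^ s : ℝ) : ℂ) * F k τ‖ₑ ≤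
      weight s (m (k, τ)) * Φ (k, τ) := by
    intro s k τ
    have hb : 0 ≤ bracket (m (k, τ)) ^ s := Real.rpow_nonneg (bracket_pos _).le s
    rw [enorm_ofReal_mul _ (mul_nonneg (hr k) hb), ENNReal.ofReal_mul (hr k), mul_comm (ENNReal.ofReal (r k)),
      mul_assoc]
    exact mul_le_mul' le_rfl (h k τ)
  rw [add_mul, one_mul]
  refine add_le_add ?_ ?_
  · refine ell2_eLpNorm_two_le hH fun k τ => (h1 _ k τ).trans ?_
    exact mul_le_mul' (weight_mono (by norm_num) _) le_rfl
  · rw [← ell2_l2norm hH, ← ell2_const_mul]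
    refine ell2_mono fun k => ?_
    rw [eLpNorm_one_eq_lintegral_enorm]
    have hwk : ∀ s, Measurable fun τ => weight s (m (k, τ)) := fun s =>
      (hw s).comp measurable_prodMk_left
    have hHk : Measurable fun τ => weight (-(7 / 16)) (m (k, τ)) * Φ (k, τ) :=
      hH.comp measurable_prodMk_left
    -- The weight `⟨σ⟩^(-1)` splits as -9/16 - 7/16; the first part is square integrable in `τ`
    -- since 9/8 > 1.
    calc ∫⁻ τ, ‖((r k / bracket (m (k, τ)) : ℝ) : ℂ) * F k τ‖ₑ
        ≤ ∫⁻ τ, weight (-(9 / 16)) (m (k, τ)) * (weight (-(7 / 16)) (m (k, τ)) * Φ (k, τ)) := by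
          refine lintegral_mono fun τ => ?_
          rw [← mul_assoc, weight_mul]
          have := h1 (-1) k τ
          rw [Real.rpow_neg_one, ← div_eq_mul_inv] at this
          norm_num at this ⊢
          exact this
      _ ≤ l2norm volume (fun τ => weight (-(9 / 16)) (m (k, τ))) *
          l2norm volume (fun τ => weight (-(7 / 16)) (m (k, τ)) * Φ (k, τ)) :=
          lintegral_mul_le_l2norm (hwk _) hHk
      _ ≤ I ^ (1 / 2 : ℝ) * l2norm volume (fun τ => weight (-(7 / 16)) (m (k, τ)) * Φ (k, τ)) := by
          gcongr
          refine ENNReal.rpow_le_rpow ?_ (by norm_num)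
          simp_rw [weight_sq]
          convert hI k using 4
          norm_num

/-- The factor 2 is not needed here; it matches the wave case, where two lines contribute, so that
`zConst` serves both. -/
lemma lintegral_weight_modS_le (α : ℝ) (k : ℤ) :
    ∫⁻ τ, weight (-(9 / 8)) (modS α (k, τ)) ≤ 2 * ∫⁻ x, weight (-(9 / 8)) x := by
  unfold modS
  simp only
  rw [lintegral_weight_sub, two_mul]
  exact le_self_add

lemma lintegral_weight_modW_le (β : ℝ) (k : ℤ) :
    ∫⁻ τ, weight (-(9 / 8)) (modW β (k, τ)) ≤ 2 * ∫⁻ x, weight (-(9 / 8)) x := by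
  have hm := measurable_weight (-(9 / 8))
  refine (lintegral_mono fun τ => weight_modW_le _ β (k, τ)).trans (le_of_eq ?_)
  simp only
  rw [lintegral_add_left (by fun_prop), lintegral_weight_sub, lintegral_weight_sub, two_mul]

/-- The constant relating a `Z` norm to the underlying weighted `L²` norm. -/
noncomputable def zConst : ℝ≥0∞ :=
  (1 + (2 * ∫⁻ x, weight (-(9 / 8)) x) ^ (1 / 2 : ℝ)) * ell2Const

lemma zConst_ne_top : zConst ≠ ∞ := by
  have h : ∫⁻ x, weight (-(9 / 8)) x ≠ ∞ := (lintegral_weight_lt_top (by norm_num)).ne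
  refine ENNReal.mul_ne_top (ENNReal.add_ne_top.2 ⟨ENNReal.one_ne_top, ?_⟩) ell2Const_ne_top
  exact ENNReal.rpow_ne_top_of_nonneg (by norm_num) (ENNReal.mul_ne_top (by norm_num) h)

lemma normZS_zero_le (α : ℝ) {F : ℤ → ℝ → ℂ} {Φ : ℤ × ℝ → ℝ≥0∞} (hΦ : Measurable Φ)
    (h : ∀ k τ, ‖F k τ‖ₑ ≤ Φ (k, τ)) :
    normZS α 0 F ≤ zConst * l2norm freqMeasure fun x => weight (-(7 / 16)) (modS α x) * Φ x := by
  rw [zConst, mul_assoc]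
  refine ell2_add_ell2_le (measurable_modS α) (lintegral_weight_modS_le α)
    (r := fun k : ℤ => bracket k ^ (0 : ℝ)) (fun k => Real.rpow_nonneg (bracket_pos _).le _) hΦ
    fun k τ => ?_
  simpa using h k τ

lemma normZW_le (β s : ℝ) {F : ℤ → ℝ → ℂ} {Φ : ℤ × ℝ → ℝ≥0∞} (hΦ : Measurable Φ)
    (h : ∀ (k : ℤ) (τ : ℝ), weight s k * ‖F k τ‖ₑ ≤ Φ (k, τ)) :
    normZW β s F ≤ zConst * l2norm freqMeasure fun x => weight (-(7 / 16)) (modW β x) * Φ x := by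
  rw [zConst, mul_assoc]
  exact ell2_add_ell2_le (measurable_modW β) (lintegral_weight_modW_le β)
    (r := fun k : ℤ => bracket k ^ s) (fun k => Real.rpow_nonneg (bracket_pos _).le _) hΦ h

/-- Only the `X` part of the `Y` norm is used, with 7/16 ≤ 1/2; the `L¹` part is dropped. -/
lemma l2norm_blockFourier_le_normYS (α : ℝ) (N : ℕ) (u : SpaceTime) :
    l2norm freqMeasure (fun x => weight (7 / 16) (modS α x) * blockFourier N u x) ≤
      ell2Const⁻¹ * normYS α 0 u.fourier := by
  rw [← ENNReal.mul_le_iff_le_inv ell2Const_ne_zero ell2Const_ne_top]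
  refine (ell2Const_mul_l2norm_le (((measurable_weight _).comp (measurable_modS α)).mul
    (measurable_blockFourier N u)) fun k τ => ?_).trans le_self_add
  have hb : 0 ≤ bracket (τ - α * k ^ 2) ^ (1 / 2 : ℝ) := Real.rpow_nonneg (bracket_pos _).le _
  rw [Real.rpow_zero, one_mul, enorm_ofReal_mul _ hb]
  refine mul_le_mul' (weight_mono (by norm_num) _) ?_
  unfold blockFourier
  split_ifs <;> simp

lemma one_le_mul_weight_of_mem_block {N : ℕ} (hN : 1 ≤ N) {k : ℤ} (hk : k ∈ block N) :
    1 ≤ ENNReal.ofReal ((3 * N) ^ (1 / 2 : ℝ)) * weight (-1 / 2) k := by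
  have hN' : (1 : ℝ) ≤ N := by exact_mod_cast hN
  have h1 : bracket k ≤ 3 * N := by
    linarith [bracket_le_one_add_abs k, abs_le_of_mem_block hk]
  rw [weight, ← ENNReal.ofReal_mul (by positivity), ENNReal.one_le_ofReal]
  calc (1 : ℝ) = bracket k ^ (1 / 2 : ℝ) * bracket k ^ (-1 / 2 : ℝ) := by
        rw [← Real.rpow_add (bracket_pos _)]; norm_num
    _ ≤ _ := by
        gcongr
        · exact Real.rpow_nonneg (bracket_pos _).le _
        · exact (bracket_pos _).le

/-- The derivative together with `⟨k⟩^(-1/2)` costs `N^(1/2)`, the same loss as removing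
`⟨k⟩^(-1/2)` from the wave norm in (1). -/
lemma abs_mul_weight_le_of_mem_block {N : ℕ} {k : ℤ} (hk : k ∈ block N) :
    weight (-1 / 2) k * ENNReal.ofReal |(k : ℝ)| ≤ ENNReal.ofReal ((3 * N) ^ (1 / 2 : ℝ)) := by
  have h1 : |(k : ℝ)| ≤ 3 * N := by
    have : (0 : ℝ) ≤ N := by positivity
    linarith [abs_le_of_mem_block hk]
  rw [weight, ← ENNReal.ofReal_mul (Real.rpow_nonneg (bracket_pos _).le _)]
  refine ENNReal.ofReal_le_ofReal ?_
  calc bracket k ^ (-1 / 2 : ℝ) * |(k : ℝ)|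
      = bracket k ^ (-1 / 2 : ℝ) * (|(k : ℝ)| ^ (1 / 2 : ℝ) * |(k : ℝ)| ^ (1 / 2 : ℝ)) := by
        rw [← Real.rpow_add_of_nonneg (abs_nonneg _) (by norm_num) (by norm_num)]; norm_num
    _ ≤ bracket k ^ (-1 / 2 : ℝ) * (bracket k ^ (1 / 2 : ℝ) * (3 * N) ^ (1 / 2 : ℝ)) := by
        have := Real.rpow_nonneg (bracket_pos k).le (-1 / 2)
        have := Real.rpow_nonneg (bracket_pos k).le (1 / 2)
        gcongr
        exact abs_le_bracket _
    _ = _ := by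
        rw [← mul_assoc, ← Real.rpow_add (bracket_pos _)]; norm_num

lemma l2norm_blockFourier_le_normYW (β : ℝ) {N : ℕ} (hN : 1 ≤ N) (v : SpaceTime) :
    l2norm freqMeasure (fun x => weight (7 / 16) (modW β x) * blockFourier N v x) ≤
      ENNReal.ofReal ((3 * N) ^ (1 / 2 : ℝ)) *
        (ell2Const⁻¹ * normYW β (-1 / 2) v.fourier) := by
  have hk : Measurable fun x : ℤ × ℝ => weight (-1 / 2) x.1 :=
    measurable_from_top (f := fun k : ℤ => weight (-1 / 2) k) |>.comp measurable_fst
  have hm : Measurable fun x : ℤ × ℝ => weight (-1 / 2) x.1 *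
      (weight (7 / 16) (modW β x) * blockFourier N v x) :=
    hk.mul (((measurable_weight _).comp (measurable_modW β)).mul (measurable_blockFourier N v))
  have h1 : l2norm freqMeasure (fun x => weight (7 / 16) (modW β x) * blockFourier N v x) ≤
      ENNReal.ofReal ((3 * N) ^ (1 / 2 : ℝ)) * l2norm freqMeasure (fun x => weight (-1 / 2) x.1 *
        (weight (7 / 16) (modW β x) * blockFourier N v x)) := by
    rw [← l2norm_const_mul hm]
    refine l2norm_mono fun x => ?_
    by_cases hx : x.1 ∈ block N
    · rw [← mul_assoc]
      exact le_mul_of_one_le_left' (one_le_mul_weight_of_mem_block hN hx)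
    · simp [blockFourier, hx]
  refine h1.trans (mul_le_mul' le_rfl ?_)
  rw [← ENNReal.mul_le_iff_le_inv ell2Const_ne_zero ell2Const_ne_top]
  refine (ell2Const_mul_l2norm_le hm fun k τ => ?_).trans le_self_add
  have hb : ∀ s x : ℝ, 0 ≤ bracket x ^ s := fun s x => Real.rpow_nonneg (bracket_pos _).le _
  rw [enorm_ofReal_mul _ (mul_nonneg (hb _ _) (hb _ _)), ENNReal.ofReal_mul (hb _ _), mul_assoc]
  refine mul_le_mul' le_rfl (mul_le_mul' (weight_mono (by norm_num) _) ?_)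
  unfold blockFourier
  split_ifs <;> simp

/-- The trilinear estimate lists the wave frequency first, whereas in (1) it stands last. -/
lemma nonresonantSet_rotate {C : ℝ} {a b c : ℤ} (h : (a, b, c) ∈ nonresonantSet C) :
    (c, a, b) ∈ nonresonantSet C := by
  refine fun hr => h ?_
  simp only [resonantSet, Comparable, Set.mem_ofPred_eq] at hr ⊢
  tauto

lemma weight_mul_weight_neg_mul (r a : ℝ) (c : ℝ≥0∞) : weight r a * (weight (-r) a * c) = c := by
  rw [← mul_assoc, mul_comm (weight r a), weight_neg_mul, one_mul]

/-! ### Duality: from the trilinear form to the two bilinear estimates. -/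

section Final

variable {α β : ℝ} {N₀ N₁ N₂ : ℕ}

lemma measurable_blockFourier_convolution (u v : SpaceTime) :
    Measurable fun x : ℤ × ℝ => if x.1 ∈ block N₀ then
      ∫⁻ y, blockFourier N₁ u y * blockFourier N₂ v (x - y) ∂freqMeasure else 0 := by
  have hs : MeasurableSet {x : ℤ × ℝ | x.1 ∈ block N₀} :=
    measurable_fst (MeasurableSet.of_discrete (s := (block N₀ : Set ℤ)))
  refine Measurable.ite hs ?_ measurable_const
  have : Measurable (Function.uncurry fun x y : ℤ × ℝ =>
      blockFourier N₁ u y * blockFourier N₂ v (x - y)) :=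
    ((measurable_blockFourier N₁ u).comp measurable_snd).mul
      ((measurable_blockFourier N₂ v).comp (measurable_fst.sub measurable_snd))
  exact this.lintegral_prod_right'

lemma measurable_blockFourier_correlation (u v : SpaceTime) :
    Measurable fun z : ℤ × ℝ => if z.1 ∈ block N₀ then
      ∫⁻ x, blockFourier N₁ u x * blockFourier N₂ v (x - z) ∂freqMeasure else 0 := by
  have hs : MeasurableSet {x : ℤ × ℝ | x.1 ∈ block N₀} :=
    measurable_fst (MeasurableSet.of_discrete (s := (block N₀ : Set ℤ)))
  refine Measurable.ite hs ?_ measurable_const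
  have : Measurable (Function.uncurry fun z x : ℤ × ℝ =>
      blockFourier N₁ u x * blockFourier N₂ v (x - z)) :=
    ((measurable_blockFourier N₁ u).comp measurable_snd).mul
      ((measurable_blockFourier N₂ v).comp (measurable_snd.sub measurable_fst))
  exact this.lintegral_prod_right'

lemma blockFourier_eq_zero (N : ℕ) (u : SpaceTime) (x : ℤ × ℝ) (hx : x.1 ∉ block N) :
    blockFourier N u x = 0 := by simp [blockFourier, hx]

/-- A test function cut off to the block of size `N`. -/
noncomputable def blockTest (N : ℕ) (m f : ℤ × ℝ → ℝ≥0∞) (x : ℤ × ℝ) : ℝ≥0∞ :=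
  if x.1 ∈ block N then m x * f x else 0

lemma measurable_blockTest (N : ℕ) {m f : ℤ × ℝ → ℝ≥0∞} (hm : Measurable m) (hf : Measurable f) :
    Measurable (blockTest N m f) :=
  Measurable.ite (measurable_fst (MeasurableSet.of_discrete (s := (block N : Set ℤ))))
    (hm.mul hf) measurable_const

lemma blockTest_eq_zero (N : ℕ) (m f : ℤ × ℝ → ℝ≥0∞) (x : ℤ × ℝ) (hx : x.1 ∉ block N) :
    blockTest N m f x = 0 := by simp [blockTest, hx]

lemma l2norm_weight_mul_blockTest_le (N : ℕ) (m : ℤ × ℝ → ℝ) (f : ℤ × ℝ → ℝ≥0∞) :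
    l2norm freqMeasure (fun x => weight (7 / 16) (m x) *
      blockTest N (fun x => weight (-(7 / 16)) (m x)) f x) ≤ l2norm freqMeasure f := by
  refine l2norm_mono fun x => ?_
  unfold blockTest
  split_ifs
  · rw [weight_mul_weight_neg_mul]
  · simp

/-- The output is a Schrödinger frequency, so the dual function fills the slot `f` of the form, `u`
fills `g` and `v` fills `h`. -/
theorem normZS_schrodingerTerm_le {E : ℝ≥0∞} (h2 : 1 ≤ N₂)
    (htri : ∀ f g h : ℤ × ℝ → ℝ≥0∞, Measurable f → Measurable g → Measurable h →
      (∀ x, x.1 ∉ block N₀ → f x = 0) → (∀ x, x.1 ∉ block N₁ → g x = 0) →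
      (∀ x, x.1 ∉ block N₂ → h x = 0) →
      ∫⁻ x, ∫⁻ y, f x * g y * h (x - y) ∂freqMeasure ∂freqMeasure ≤
        E * (l2norm freqMeasure (fun x => weight (7 / 16) (modS α x) * f x) *
          l2norm freqMeasure (fun x => weight (7 / 16) (modS α x) * g x) *
          l2norm freqMeasure (fun x => weight (7 / 16) (modW β x) * h x))) (u v : SpaceTime) :
    normZS α 0 (spaceTimeFourier (schrodingerTerm N₀ N₁ N₂ u v)) ≤
      zConst * ell2Const⁻¹ ^ 2 * E * ENNReal.ofReal ((3 * N₂) ^ (1 / 2 : ℝ)) *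
        normYS α 0 u.fourier * normYW β (-1 / 2) v.fourier := by
  have hΦ := measurable_blockFourier_convolution (N₀ := N₀) (N₁ := N₁) (N₂ := N₂) u v
  refine (normZS_zero_le α hΦ fun k τ =>
    enorm_spaceTimeFourier_schrodingerTerm_le N₀ N₁ N₂ u v k τ).trans ?_
  set P := l2norm freqMeasure (fun x => weight (7 / 16) (modS α x) * blockFourier N₁ u x) with hP
  set Q := l2norm freqMeasure (fun x => weight (7 / 16) (modW β x) * blockFourier N₂ v x) with hQ
  have hw : Measurable fun x => weight (-(7 / 16)) (modS α x) :=
    (measurable_weight _).comp (measurable_modS α)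
  have hu := measurable_blockFourier N₁ u
  have hv := measurable_blockFourier N₂ v
  have hdual : l2norm freqMeasure (fun x => weight (-(7 / 16)) (modS α x) *
      (if x.1 ∈ block N₀ then
      ∫⁻ y, blockFourier N₁ u y * blockFourier N₂ v (x - y) ∂freqMeasure else 0)) ≤
      E * P * Q := by
    refine l2norm_le_of_forall_lintegral_mul_le _ (hw.mul hΦ) fun f hf => ?_
    set F := blockTest N₀ (fun x => weight (-(7 / 16)) (modS α x)) f with hF
    have hFm : Measurable F := measurable_blockTest N₀ hw hf
    calc ∫⁻ x, f x * (weight (-(7 / 16)) (modS α x) * (if x.1 ∈ block N₀ then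
            ∫⁻ y, blockFourier N₁ u y * blockFourier N₂ v (x - y) ∂freqMeasure else 0))
            ∂freqMeasure
        = ∫⁻ x, ∫⁻ y, F x * blockFourier N₁ u y * blockFourier N₂ v (x - y)
            ∂freqMeasure ∂freqMeasure := by
          refine lintegral_congr fun x => ?_
          have hm : Measurable fun y => blockFourier N₁ u y * blockFourier N₂ v (x - y) :=
            hu.mul (hv.comp (measurable_const.sub measurable_id))
          simp_rw [mul_assoc (F x)]
          rw [lintegral_const_mul _ hm, hF, blockTest]
          split_ifs
          · ring
          · simp
      _ ≤ E * (l2norm freqMeasure (fun x => weight (7 / 16) (modS α x) * F x) * P * Q) :=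
          htri F _ _ hFm hu hv (blockTest_eq_zero _ _ _) (blockFourier_eq_zero _ _)
            (blockFourier_eq_zero _ _)
      _ ≤ E * (l2norm freqMeasure f * P * Q) := by
          gcongr
          exact l2norm_weight_mul_blockTest_le N₀ (modS α) f
      _ = E * P * Q * l2norm freqMeasure f := by ring
  calc _ ≤ zConst * (E * P * Q) := by gcongr
    _ ≤ zConst * (E * (ell2Const⁻¹ * normYS α 0 u.fourier) *
        (ENNReal.ofReal ((3 * N₂) ^ (1 / 2 : ℝ)) *
          (ell2Const⁻¹ * normYW β (-1 / 2) v.fourier))) := by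
        gcongr
        · exact l2norm_blockFourier_le_normYS α N₁ u
        · exact l2norm_blockFourier_le_normYW β h2 v
    _ = _ := by ring

/-- Here the output is the wave frequency `z = x - y`, so the dual function fills the slot `h` after
the substitution `y = x - z`. -/
theorem normZW_waveTerm_le {E : ℝ≥0∞}
    (htri : ∀ f g h : ℤ × ℝ → ℝ≥0∞, Measurable f → Measurable g → Measurable h →
      (∀ x, x.1 ∉ block N₁ → f x = 0) → (∀ x, x.1 ∉ block N₂ → g x = 0) →
      (∀ x, x.1 ∉ block N₀ → h x = 0) →
      ∫⁻ x, ∫⁻ y, f x * g y * h (x - y) ∂freqMeasure ∂freqMeasure ≤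
        E * (l2norm freqMeasure (fun x => weight (7 / 16) (modS α x) * f x) *
          l2norm freqMeasure (fun x => weight (7 / 16) (modS α x) * g x) *
          l2norm freqMeasure (fun x => weight (7 / 16) (modW β x) * h x))) (u v : SpaceTime) :
    normZW β (-1 / 2) (spaceTimeFourier (waveTerm N₀ N₁ N₂ u v)) ≤
      zConst * ell2Const⁻¹ ^ 2 * E * ENNReal.ofReal ((3 * N₀) ^ (1 / 2 : ℝ)) *
        normYS α 0 u.fourier * normYS α 0 v.fourier := by
  have hΦ := measurable_blockFourier_correlation (N₀ := N₀) (N₁ := N₁) (N₂ := N₂) u v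
  set c := ENNReal.ofReal ((3 * N₀) ^ (1 / 2 : ℝ)) with hc
  refine (normZW_le β (-1 / 2) (hΦ.const_mul c) fun k τ => ?_).trans ?_
  · refine (mul_le_mul' le_rfl (enorm_spaceTimeFourier_waveTerm_le N₀ N₁ N₂ u v k τ)).trans ?_
    simp only
    split_ifs with hk
    · rw [← mul_assoc]
      exact mul_le_mul' (abs_mul_weight_le_of_mem_block hk) le_rfl
    · simp
  set P := l2norm freqMeasure (fun x => weight (7 / 16) (modS α x) * blockFourier N₁ u x) with hP
  set Q := l2norm freqMeasure (fun x => weight (7 / 16) (modS α x) * blockFourier N₂ v x) with hQ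
  have hw : Measurable fun x => weight (-(7 / 16)) (modW β x) :=
    (measurable_weight _).comp (measurable_modW β)
  have hu := measurable_blockFourier N₁ u
  have hv := measurable_blockFourier N₂ v
  have hdual : l2norm freqMeasure (fun z => weight (-(7 / 16)) (modW β z) *
      (if z.1 ∈ block N₀ then
      ∫⁻ x, blockFourier N₁ u x * blockFourier N₂ v (x - z) ∂freqMeasure else 0)) ≤
      E * P * Q := by
    refine l2norm_le_of_forall_lintegral_mul_le _ (hw.mul hΦ) fun f hf => ?_
    set F := blockTest N₀ (fun x => weight (-(7 / 16)) (modW β x)) f with hF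
    have hFm : Measurable F := measurable_blockTest N₀ hw hf
    have hjoint : Measurable (Function.uncurry fun z x : ℤ × ℝ =>
        blockFourier N₁ u x * blockFourier N₂ v (x - z) * F z) :=
      ((hu.comp measurable_snd).mul (hv.comp (measurable_snd.sub measurable_fst))).mul
        (hFm.comp measurable_fst)
    calc ∫⁻ z, f z * (weight (-(7 / 16)) (modW β z) * (if z.1 ∈ block N₀ then
            ∫⁻ x, blockFourier N₁ u x * blockFourier N₂ v (x - z) ∂freqMeasure else 0))
            ∂freqMeasure
        = ∫⁻ z, ∫⁻ x, blockFourier N₁ u x * blockFourier N₂ v (x - z) * F z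
            ∂freqMeasure ∂freqMeasure := by
          refine lintegral_congr fun z => ?_
          have hm : Measurable fun x => blockFourier N₁ u x * blockFourier N₂ v (x - z) :=
            hu.mul (hv.comp (measurable_id.sub measurable_const))
          rw [lintegral_mul_const _ hm, hF, blockTest]
          split_ifs
          · ring
          · simp
      _ = ∫⁻ x, ∫⁻ y, blockFourier N₁ u x * blockFourier N₂ v y * F (x - y)
            ∂freqMeasure ∂freqMeasure := by
          rw [lintegral_lintegral_swap hjoint.aemeasurable]
          refine lintegral_congr fun x => ?_
          rw [← lintegral_sub_left_eq_self _ x]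
          simp
      _ ≤ E * (P * Q * l2norm freqMeasure (fun x => weight (7 / 16) (modW β x) * F x)) :=
          htri _ _ F hu hv hFm (blockFourier_eq_zero _ _) (blockFourier_eq_zero _ _)
            (blockTest_eq_zero _ _ _)
      _ ≤ E * (P * Q * l2norm freqMeasure f) := by
          gcongr
          exact l2norm_weight_mul_blockTest_le N₀ (modW β) f
      _ = E * P * Q * l2norm freqMeasure f := by ring
  simp_rw [mul_left_comm _ c]
  have hH : Measurable fun z : ℤ × ℝ => weight (-(7 / 16)) (modW β z) * (if z.1 ∈ block N₀ then
      ∫⁻ x, blockFourier N₁ u x * blockFourier N₂ v (x - z) ∂freqMeasure else 0) := hw.mul hΦ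
  rw [l2norm_const_mul hH]
  calc _ ≤ zConst * (c * (E * P * Q)) := by gcongr
    _ ≤ zConst * (c * (E * (ell2Const⁻¹ * normYS α 0 u.fourier) *
          (ell2Const⁻¹ * normYS α 0 v.fourier))) := by
        gcongr
        · exact l2norm_blockFourier_le_normYS α N₁ u
        · exact l2norm_blockFourier_le_normYS α N₂ v
    _ = _ := by ring

end Final

/-! ### Collecting the constants. -/

lemma one_le_of_isDyadic {N : ℕ} (h : IsDyadic N) : 1 ≤ N := by
  obtain ⟨j, rfl⟩ := h
  exact Nat.one_le_two_pow

/-- Here `N` is the size of the wave frequency: the gain `N^(-1/2)` of the trilinear estimate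
cancels the loss `(3N)^(1/2)` up to `3^(1/2)`. -/
lemma constants_le {D : ℝ≥0∞} (hD : D ≠ ∞) {A δ : ℝ} (hA : 0 < A) (hδ : δ ≤ 1 / 8)
    {M N : ℕ} (hM : 1 ≤ M) (hN : 1 ≤ N) :
    D * ENNReal.ofReal (A * (M : ℝ) ^ (-(1 / 8) : ℝ) * (N : ℝ) ^ (-(1 / 2) : ℝ)) *
      ENNReal.ofReal ((3 * N) ^ (1 / 2 : ℝ)) ≤
      ENNReal.ofReal ((D.toReal * A * 3 ^ (1 / 2 : ℝ) + 1) * (M : ℝ) ^ (-δ)) := by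
  have hM' : (1 : ℝ) ≤ M := by exact_mod_cast hM
  have hN' : (1 : ℝ) ≤ N := by exact_mod_cast hN
  have hD0 : 0 ≤ D.toReal := ENNReal.toReal_nonneg
  rw [← ENNReal.ofReal_toReal hD, ENNReal.toReal_ofReal hD0, ← ENNReal.ofReal_mul hD0,
    ← ENNReal.ofReal_mul (by positivity)]
  refine ENNReal.ofReal_le_ofReal ?_
  have h1 : (N : ℝ) ^ (-(1 / 2) : ℝ) * (N : ℝ) ^ (1 / 2 : ℝ) = 1 := by
    rw [← Real.rpow_add (by positivity)]; simp
  have h2 : (M : ℝ) ^ (-(1 / 8) : ℝ) ≤ (M : ℝ) ^ (-δ) :=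
    Real.rpow_le_rpow_of_exponent_le hM' (by linarith)
  rw [Real.mul_rpow (by norm_num) (by positivity)]
  calc D.toReal * (A * (M : ℝ) ^ (-(1 / 8) : ℝ) * (N : ℝ) ^ (-(1 / 2) : ℝ)) *
        (3 ^ (1 / 2 : ℝ) * (N : ℝ) ^ (1 / 2 : ℝ))
      = D.toReal * A * 3 ^ (1 / 2 : ℝ) * (M : ℝ) ^ (-(1 / 8) : ℝ) *
        ((N : ℝ) ^ (-(1 / 2) : ℝ) * (N : ℝ) ^ (1 / 2 : ℝ)) := by ring
    _ ≤ (D.toReal * A * 3 ^ (1 / 2 : ℝ) + 1) * (M : ℝ) ^ (-δ) * 1 := by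
        rw [h1]
        gcongr
        linarith
    _ = _ := mul_one _

theorem proposition4p2 (α β : ℝ) (hα : 0 < α) (hβ : 0 < β) (hβα : ∀ m : ℤ, β / α ≠ (m : ℝ)) :
    ∃ δ₀ : ℝ, 0 < δ₀ ∧ ∀ C : ℝ, 2 < C → ∀ δ : ℝ, 0 < δ → δ ≤ δ₀ →
      ∃ K : ℝ, 0 < K ∧ ∀ N₀ N₁ N₂ : ℕ, IsDyadic N₀ → IsDyadic N₁ → IsDyadic N₂ →
        (NonresonantSum C N₀ N₁ N₂ → ∀ u v : SpaceTime,
          normZS α 0 (spaceTimeFourier (schrodingerTerm N₀ N₁ N₂ u v)) ≤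
            ENNReal.ofReal (K * ((max N₀ (max N₁ N₂) : ℕ) : ℝ) ^ (-δ)) *
              normYS α 0 u.fourier * normYW β (-1 / 2) v.fourier) ∧
        (NonresonantDiff C N₀ N₁ N₂ → ∀ u v : SpaceTime,
          normZW β (-1 / 2) (spaceTimeFourier (waveTerm N₀ N₁ N₂ u v)) ≤
            ENNReal.ofReal (K * ((max N₀ (max N₁ N₂) : ℕ) : ℝ) ^ (-δ)) *
              normYS α 0 u.fourier * normYS α 0 v.fourier) := by
  refine ⟨1 / 8, by norm_num, fun C hC δ _ hδ => ?_⟩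
  obtain ⟨A, hA, htri⟩ := exists_trilinear_bound hα hβ hβα hC
  have hD : zConst * ell2Const⁻¹ ^ 2 ≠ ∞ := ENNReal.mul_ne_top zConst_ne_top
    (ENNReal.pow_ne_top (ENNReal.inv_ne_top.2 ell2Const_ne_zero))
  -- Adding 1 makes `K` positive without a lower bound on `zConst`.
  refine ⟨(zConst * ell2Const⁻¹ ^ 2).toReal * A * 3 ^ (1 / 2 : ℝ) + 1, by positivity, ?_⟩
  intro N₀ N₁ N₂ d0 d1 d2
  have h0 := one_le_of_isDyadic d0
  have h1 := one_le_of_isDyadic d1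
  have h2 := one_le_of_isDyadic d2
  have hM : 1 ≤ max N₀ (max N₁ N₂) := h0.trans (le_max_left _ _)
  refine ⟨fun hnr u v => ?_, fun hnr u v => ?_⟩
  · refine (normZS_schrodingerTerm_le h2 (htri N₀ N₁ N₂ h0 h1 h2 fun k hk l hl hkl =>
      nonresonantSet_rotate (hnr k hk l hl (k - l) hkl (by ring))) u v).trans ?_
    gcongr
    exact constants_le hD hA hδ hM h2
  · have hmax : max N₁ (max N₂ N₀) = max N₀ (max N₁ N₂) := by
      rw [← max_assoc, max_comm]
    have htri' := htri N₁ N₂ N₀ h1 h2 h0 fun k hk l hl hkl => hnr (k - l) hkl k hk l hl rfl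
    rw [hmax] at htri'
    refine (normZW_waveTerm_le htri' u v).trans ?_
    gcongr
    exact constants_le hD hA hδ hM h0
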